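/- **Setting.** Let $\mathbb F_q$ be a finite field of characteristic $\neq 2$ and $\delta\in\mathbb F_q^*$ a fixed non-square. Consider the series $B_n$ ($O(M)$, $M=2n+1$), $C_n$ ($Sp(M)$, $M=2n$) and $D_n$ ($O(M)$, $M=2n$). Rows and columns of $M\times M$ matrices are labelled, in this order, by $I=\{n>\dots>1>0>-1>\dots>-n\}$, where $0$ is omitted for $C_n$, $D_n$. Put $X^\dagger=KX^tK^{-1}$, where $K$ is the antidiagonal matrix of ones $\mathbb I_M$ for $B_n$, $D_n$, and $K=\begin{pmatrix}0&\mathbb I_n\\-\mathbb I_n&0\end{pmatrix}$ for $C_n$. Let $I=I_\ell\sqcup\dots\sqcup I_0\sqcup\dots\sqcup I_{-\ell}$ be a partition into consecutive segments (in the order above) with $I_{-k}=-I_k$; all segments are non-empty, except that $I_0$ may be empty. Let $\mathfrak p=\mathfrak l\oplus\mathcal U_+$ be the algebra of block upper triangular matrices, $\mathcal U_-$ the space of strictly block lower triangular matrices, and let $\mathfrak{gl}^a(M)=\mathfrak p\oplus\mathcal U_-^a$ be the associative algebra with the product $(x+\lambda)(y+\mu)=xy+\pi_-(x\mu+\lambda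 y)$, where $x,y\in\mathfrak p$, $\lambda,\mu\in\mathcal U_-$, the products on the right are products of matrices, and $\pi_-$ is the projection of matrices to $\mathcal U_-$. Its group of invertible elements $\mathbf G^a$ is the parabolic contraction of $GL(M,\mathbb F_q)$. The map $\dagger$ is an antiautomorphism of $\mathfrak{gl}^a(M)$. Let $\mathfrak u^a=\{X\in\mathcal U_+\oplus\mathcal U_-^a: X^\dagger=-X\}$; the group $\mathbf G^a$ acts on it by $g\centerdot X=gXg^\dagger$ (product in $\mathfrak{gl}^a(M)$). The positive roots are identified with the pairs $(i,j)$ (for $\epsilon_i-\epsilon_j$) and $(i,-j)$ (for $\epsilon_i+\epsilon_j$), $i>j>0$, together with $(i,0)$, $i>0$ (for $\epsilon_i$) in the case $B_n$ and $(i,-i)$, $i>0$ (for $2\epsilon_i$) in the case $C_n$; the pair of $-\alpha$ is the transpose of the pair of $\alpha$. For $\alpha=(i,j)$ put $\alpha'=(-j,-i)$, and $D'=\{\alpha':\alpha\in D\}$ for a set $D$ of roots. The root vector of $\alpha$ is $e_\alpha=E_\alpha+\eta(\alpha)E_{\alpha'}$, where $E_{\alpha}$ are the matrix units and $\eta(\alpha)\in\{1,0,-1\}$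 is such that $e_\alpha^\dagger=-e_\alpha$ ($\eta(\alpha)=0$ if $\alpha'=\alpha$, and $\eta(\alpha)=\pm1$ otherwise). Let $\Delta(\mathfrak u^a)$ be the set of roots $\alpha\in I_k\times I_m$ with $k\ne m$. A subset $D\subset\Delta(\mathfrak u^a)$ is a *rook placement* if every row and every column contains at most one pair of $D\cup D'$. For a rook placement $D$ and a map $\phi:D\to\mathbb F_q^*$ put $\mathcal X_{D,\phi}=\sum_{\gamma\in D}\phi(\gamma)e_\gamma\in\mathfrak u^a$. The pair $(D,\phi)$ is *basic* if, in the cases $B_n$, $D_n$, $\phi\equiv1$; and, in the case $C_n$: (1) $\phi(\gamma)\in\{1,\delta\}$ for all $\gamma\in D$; (2) $\phi(\gamma)=\delta$ implies that $\gamma$ is antidiagonal, i.e. $\gamma=(i,-i)$; (3) for every $k$, all roots of $D\cap(I_k\times I_{-k})$ are antidiagonal, and at most one of them satisfies $\phi(\gamma)=\delta$. For $-\ell\le k,m\le\ell$ with $k\ne m$ put $r_{km}(D)=|(D\cup D')\cap(I_k\times I_m)|$. Put $d_k(\phi)=-1$ if there is $\gamma\in D\cap(I_k\times I_{-k})$ with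 $\phi(\gamma)=\delta$, and $d_k(\phi)=1$ otherwise (so $d_k(\phi)=1$ always for $B_n$, $D_n$). **Statement.** Let $(D_1,\phi_1)$ and $(D_2,\phi_2)$ be basic pairs. The elements $\mathcal X_{D_1,\phi_1}$ and $\mathcal X_{D_2,\phi_2}$ belong to a common $\mathbf G^a$-orbit in $\mathfrak u^a$ if and only if $r_{km}(D_1)=r_{km}(D_2)$ for all $-\ell\le k,m\le\ell$, $k\neq m$, and $d_k(\phi_1)=d_k(\phi_2)$ for all $-\ell\le k\le\ell$, $k\ne0$. -/

import Mathlib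

noncomputable section

namespace ParabolicContraction

/-- The three series of groups: `B` is `O(2n+1)`, `C` is `Sp(2n)`, `D` is `O(2n)`. -/
inductive Series : Type
  | B
  | C
  | D
  deriving DecidableEq

/-- The set `I` of labels of rows and columns: `[-n, n]` for the series `B`, and
`[-n, n] \ {0}` for the series `C` and `D`. -/
def labels (T : Series) (n : ℕ) : Finset ℤ :=
  if T = Series.B then Finset.Icc (-(n : ℤ)) n else (Finset.Icc (-(n : ℤ)) n).erase 0

/-- The labels of rows and columns, as a type. Rows and columns are written in decreasing order
of labels, so the entry `(i, j)` of a matrix lies above the diagonal when `i > j`. -/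
abbrev Label (T : Series) (n : ℕ) : Type := {i : ℤ // i ∈ labels T n}

theorem neg_mem_labels {T : Series} {n : ℕ} {i : ℤ} (h : i ∈ labels T n) : -i ∈ labels T n := by
  unfold labels at *
  split_ifs at * <;> simp at * <;> omega

/-- The label `-i`. -/
def opp {T : Series} {n : ℕ} (i : Label T n) : Label T n := ⟨-i.1, neg_mem_labels i.2⟩

@[simp] theorem opp_val {T : Series} {n : ℕ} (i : Label T n) : (opp i).1 = -i.1 := rfl

@[simp] theorem opp_opp {T : Series} {n : ℕ} (i : Label T n) : opp (opp i) = i :=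
  Subtype.ext (neg_neg _)

/-- Negation of labels, as a permutation. -/
def oppEquiv (T : Series) (n : ℕ) : Label T n ≃ Label T n := ⟨opp, opp, opp_opp, opp_opp⟩

/-- A partition of the set of labels into consecutive segments `I_ℓ, …, I_0, …, I_{-ℓ}` (in the
order of rows and columns), symmetric relative to zero. The segment `I_k` is the set of `i` with
`block i = k`. All segments are nonempty, except that there may be no middle segment `I_0`. -/
structure SymPartition (T : Series) (n : ℕ) where
  ℓ : ℕ
  block : Label T n → ℤ
  monotone : Monotone block
  block_opp : ∀ i, block (opp i) = -block i
  abs_block_le : ∀ i, |block i| ≤ ℓ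
  exists_block : ∀ k : ℤ, k ≠ 0 → |k| ≤ ℓ → ∃ i, block i = k

section Algebra

variable (F : Type*) [Field F] {T : Series} {n : ℕ}

/-- The sign `±1` of the entry `(i, -i)` of the matrix of the form. -/
def sgn (T : Series) {n : ℕ} (i : Label T n) : F := if T = Series.C ∧ i.1 < 0 then -1 else 1

variable {F}

theorem sgn_mul_self (i : Label T n) : sgn F T i * sgn F T i = 1 := by
  unfold sgn; split_ifs <;> simp

theorem sgn_opp_mul (i j : Label T n) :
    sgn F T (opp i) * sgn F T (opp j) = sgn F T i * sgn F T j := by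
  have h : ∀ i : Label T n, T = Series.C → i.1 ≠ 0 := by
    rintro ⟨i, hi⟩ hT
    simp only [labels, hT] at hi
    simp at hi
    exact hi.1
  unfold sgn
  by_cases hT : T = Series.C
  · have h1 := h i hT
    have h2 := h j hT
    simp only [hT, true_and, opp_val]
    split_ifs <;> first | omega | simp
  · simp [hT]

variable (F) in
/-- The matrix of the form: the antidiagonal matrix of ones for the series `B` and `D`, and the
matrix `[[0, 𝕀], [-𝕀, 0]]`, where `𝕀` is the antidiagonal matrix of ones, for the series `C`. -/
def formMatrix (T : Series) (n : ℕ) : Matrix (Label T n) (Label T n) F :=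
  Matrix.of fun i j => if j = opp i then sgn F T i else 0

/-- The involutive antiautomorphism `X† = K Xᵗ K⁻¹` of the algebra of all matrices, where `K` is
the matrix of the form; note that `K⁻¹ = Kᵗ`. -/
def dagger (X : Matrix (Label T n) (Label T n) F) : Matrix (Label T n) (Label T n) F :=
  formMatrix F T n * X.transpose * (formMatrix F T n).transpose

theorem dagger_apply (X : Matrix (Label T n) (Label T n) F) (i j : Label T n) :
    dagger X i j = sgn F T i * sgn F T j * X (opp j) (opp i) := by
  simp [dagger, formMatrix, Matrix.mul_apply]
  ring

/-- The part of a matrix in the parabolic subalgebra (blocks `I_k × I_m` with `k ≥ m`, i.e. on and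
above the diagonal). -/
def parPart (P : SymPartition T n) (X : Matrix (Label T n) (Label T n) F) :
    Matrix (Label T n) (Label T n) F :=
  Matrix.of fun i j => if P.block j ≤ P.block i then X i j else 0

/-- The part of a matrix below the block diagonal (blocks `I_k × I_m` with `k < m`). -/
def lowPart (P : SymPartition T n) (X : Matrix (Label T n) (Label T n) F) :
    Matrix (Label T n) (Label T n) F :=
  Matrix.of fun i j => if P.block i < P.block j then X i j else 0

variable (F) in
/-- The associative algebra `𝔤𝔩ᵃ(M) = 𝔭 ⊕ 𝔲₋ᵃ`, the parabolic contraction of `𝔤𝔩(M)`. Its elements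
are matrices, the sum of the parabolic part (in `𝔭`) and of the part below the block diagonal
(in `𝔲₋ᵃ`); the multiplication is not the one of matrices, see below. -/
def ContractedAlgebra (_P : SymPartition T n) : Type _ := Matrix (Label T n) (Label T n) F

variable {P : SymPartition T n}

instance : AddCommGroup (ContractedAlgebra F P) :=
  inferInstanceAs (AddCommGroup (Matrix (Label T n) (Label T n) F))

instance : Module F (ContractedAlgebra F P) :=
  inferInstanceAs (Module F (Matrix (Label T n) (Label T n) F))

/-- `(x + λ)(y + μ) = xy + (xμ + λy)`, where `xy` is the product of matrices and `xμ`, `λy` are the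
left and right coadjoint actions of `𝔭` on `𝔲₋ᵃ = 𝔲₊*`, that is `(xμ)(z) = μ(zx)` and
`(λy)(z) = λ(yz)`. With the trace pairing of `𝔲₋` and `𝔲₊`, they are the products of matrices,
projected to `𝔲₋`; the product of two elements of `𝔲₋ᵃ` is zero. -/
instance : Mul (ContractedAlgebra F P) where
  mul X Y :=
    let x : Matrix (Label T n) (Label T n) F := parPart P X
    let lam : Matrix (Label T n) (Label T n) F := lowPart P X
    let y : Matrix (Label T n) (Label T n) F := parPart P Y
    let mu : Matrix (Label T n) (Label T n) F := lowPart P Y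
    x * y + lowPart P (x * mu + lam * y)

instance : One (ContractedAlgebra F P) where
  one := (1 : Matrix (Label T n) (Label T n) F)

/-- Reading off matrix entries. -/
def entry (X : ContractedAlgebra F P) (i j : Label T n) : F :=
  (show Matrix (Label T n) (Label T n) F from X) i j

@[ext] theorem ContractedAlgebra.ext {X Y : ContractedAlgebra F P}
    (h : ∀ i j, entry X i j = entry Y i j) : X = Y :=
  Matrix.ext h

@[simp] theorem entry_add (X Y : ContractedAlgebra F P) (i j : Label T n) :
    entry (X + Y) i j = entry X i j + entry Y i j := rfl

@[simp] theorem entry_neg (X : ContractedAlgebra F P) (i j : Label T n) :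
    entry (-X) i j = -entry X i j := rfl

@[simp] theorem entry_zero (i j : Label T n) :
    entry (0 : ContractedAlgebra F P) i j = 0 := rfl

@[simp] theorem entry_smul (c : F) (X : ContractedAlgebra F P) (i j : Label T n) :
    entry (c • X) i j = c * entry X i j := rfl

theorem entry_one (i j : Label T n) :
    entry (1 : ContractedAlgebra F P) i j = if i = j then 1 else 0 := rfl

/-- Which products of matrix units in blocks `(a, b)` and `(b, c)` survive in the contraction. -/
def Survives (a b c : ℤ) : Prop := (b ≤ a ∧ c ≤ b) ∨ (a < c ∧ (b ≤ a ∨ c ≤ b))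

instance (a b c : ℤ) : Decidable (Survives a b c) := by unfold Survives; infer_instance

theorem entry_mul (X Y : ContractedAlgebra F P) (i j : Label T n) :
    entry (X * Y) i j = ∑ k, if Survives (P.block i) (P.block k) (P.block j) then
      entry X i k * entry Y k j else 0 := by
  change (parPart P X * parPart P Y + lowPart P (parPart P X * lowPart P Y +
    lowPart P X * parPart P Y) : Matrix (Label T n) (Label T n) F) i j = _
  simp only [Matrix.add_apply, lowPart, parPart, Matrix.mul_apply, Matrix.of_apply]
  by_cases h : P.block i < P.block j
  · simp only [if_pos h]
    rw [← Finset.sum_add_distrib, ← Finset.sum_add_distrib]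
    refine Finset.sum_congr rfl fun k _ => ?_
    by_cases hs : Survives (P.block i) (P.block k) (P.block j)
    all_goals
      simp only [hs, if_true, if_false, entry]
      unfold Survives at hs
      split_ifs <;> first | (exfalso; omega) | simp
  · simp only [if_neg h, add_zero]
    refine Finset.sum_congr rfl fun k _ => ?_
    by_cases hs : Survives (P.block i) (P.block k) (P.block j)
    all_goals
      simp only [hs, if_true, if_false, entry]
      unfold Survives at hs
      split_ifs <;> first | (exfalso; omega) | simp

instance : Ring (ContractedAlgebra F P) :=
  { (inferInstance : AddCommGroup (ContractedAlgebra F P)) with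
    mul := (· * ·)
    one := 1
    left_distrib := fun X Y Z => by
      ext i j
      change entry (X * (Y + Z)) i j = entry (X * Y) i j + entry (X * Z) i j
      simp only [entry_mul, entry_add]
      rw [← Finset.sum_add_distrib]
      refine Finset.sum_congr rfl fun k _ => ?_
      split_ifs <;> ring
    right_distrib := fun X Y Z => by
      ext i j
      change entry ((X + Y) * Z) i j = entry (X * Z) i j + entry (Y * Z) i j
      simp only [entry_mul, entry_add]
      rw [← Finset.sum_add_distrib]
      refine Finset.sum_congr rfl fun k _ => ?_
      split_ifs <;> ring
    zero_mul := fun X => by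
      ext i j
      change entry (0 * X) i j = entry (0 : ContractedAlgebra F P) i j
      simp [entry_mul]
    mul_zero := fun X => by
      ext i j
      change entry (X * 0) i j = entry (0 : ContractedAlgebra F P) i j
      simp [entry_mul]
    one_mul := fun X => by
      ext i j
      rw [entry_mul, Finset.sum_eq_single i]
      · have : Survives (P.block i) (P.block i) (P.block j) := by unfold Survives; omega
        simp [entry_one, this]
      · intro k _ hk
        simp [entry_one, hk.symm]
      · simp
    mul_one := fun X => by
      ext i j
      rw [entry_mul, Finset.sum_eq_single j]
      · have : Survives (P.block i) (P.block j) (P.block j) := by unfold Survives; omega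
        simp [entry_one, this]
      · intro k _ hk
        simp [entry_one, hk]
      · simp
    mul_assoc := fun X Y Z => by
      ext i j
      change entry (X * Y * Z) i j = entry (X * (Y * Z)) i j
      simp only [entry_mul]
      have hL : ∀ k, (if Survives (P.block i) (P.block k) (P.block j) then
          (∑ l, if Survives (P.block i) (P.block l) (P.block k) then
            entry X i l * entry Y l k else 0) * entry Z k j else 0) =
          ∑ l, if Survives (P.block i) (P.block k) (P.block j) ∧
            Survives (P.block i) (P.block l) (P.block k) then
              entry X i l * entry Y l k * entry Z k j else 0 := by
        intro k
        split_ifs with h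
        · rw [Finset.sum_mul]
          refine Finset.sum_congr rfl fun l _ => ?_
          simp only [h, true_and]
          split_ifs <;> simp
        · simp [h]
      have hR : ∀ l, (if Survives (P.block i) (P.block l) (P.block j) then
          entry X i l * (∑ k, if Survives (P.block l) (P.block k) (P.block j) then
            entry Y l k * entry Z k j else 0) else 0) =
          ∑ k, if Survives (P.block i) (P.block l) (P.block j) ∧
            Survives (P.block l) (P.block k) (P.block j) then
              entry X i l * entry Y l k * entry Z k j else 0 := by
        intro l
        split_ifs with h
        · rw [Finset.mul_sum]
          refine Finset.sum_congr rfl fun k _ => ?_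
          simp only [h, true_and]
          split_ifs <;> simp [mul_assoc]
        · simp [h]
      rw [Finset.sum_congr rfl fun k _ => hL k, Finset.sum_congr rfl fun l _ => hR l,
        Finset.sum_comm]
      refine Finset.sum_congr rfl fun l _ => Finset.sum_congr rfl fun k _ => ?_
      congr 1
      apply propext
      unfold Survives
      omega }

/-- The extension of `X ↦ X†` to the contracted algebra; it is linear and acts on the parts in `𝔭`
and in `𝔲₋ᵃ` separately, since the partition is symmetric. -/
instance : Star (ContractedAlgebra F P) where
  star X := dagger (show Matrix (Label T n) (Label T n) F from X)

theorem entry_star (X : ContractedAlgebra F P) (i j : Label T n) :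
    entry (star X) i j = sgn F T i * sgn F T j * entry X (opp j) (opp i) :=
  dagger_apply _ i j

instance : StarRing (ContractedAlgebra F P) where
  star_involutive X := by
    ext i j
    rw [entry_star, entry_star, opp_opp, opp_opp, sgn_opp_mul]
    linear_combination (entry X i j) *
      (sgn F T j * sgn F T j * sgn_mul_self (F := F) i + sgn_mul_self (F := F) j)
  star_mul X Y := by
    ext i j
    rw [entry_star, entry_mul, entry_mul, Finset.mul_sum, ← (oppEquiv T n).sum_comp]
    refine Finset.sum_congr rfl fun k _ => ?_
    have hk : oppEquiv T n k = opp k := rfl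
    have : Survives (-P.block j) (-P.block k) (-P.block i) ↔
        Survives (P.block i) (P.block k) (P.block j) := by
      unfold Survives; omega
    simp only [hk, P.block_opp, this, entry_star]
    split_ifs
    · linear_combination (-(sgn F T i * sgn F T j * entry X (opp j) (opp k) *
        entry Y (opp k) (opp i))) * sgn_mul_self (F := F) k
    · simp
  star_add X Y := by
    ext i j
    simp only [entry_star, entry_add]
    ring

variable (F P)

/-- The group `𝐆ᵃ = 𝐏 ⋉ 𝐔₋ᵃ`, the parabolic contraction of `GL(M)`, realized as the group of
invertible elements of the contracted algebra. -/
abbrev ContractedGL : Type _ := (ContractedAlgebra F P)ˣ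

/-- The space `𝔲ᵃ = 𝔲₊ ⊕ 𝔲₋ᵃ` for the orthogonal or symplectic group: the elements with zero diagonal
blocks such that `X† = -X`. -/
def nilSpace : Submodule F (ContractedAlgebra F P) where
  carrier := {X | (∀ i j, P.block i = P.block j → entry X i j = 0) ∧ star X = -X}
  zero_mem' := ⟨fun _ _ _ => rfl, by simp⟩
  add_mem' := by
    rintro X Y ⟨hX, hX'⟩ ⟨hY, hY'⟩
    refine ⟨fun i j h => by simp [hX i j h, hY i j h], ?_⟩
    rw [star_add, hX', hY', neg_add]
  smul_mem' := by
    rintro c X ⟨hX, hX'⟩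
    refine ⟨fun i j h => by simp [hX i j h], ?_⟩
    ext i j
    have := congrArg (fun Z => entry Z i j) hX'
    simp only [entry_star, entry_neg, entry_smul] at this ⊢
    linear_combination c * this

variable {F P}

theorem entry_mul_eq_zero_left {X Y : ContractedAlgebra F P}
    (hY : ∀ i j, P.block i = P.block j → entry Y i j = 0) (i j : Label T n)
    (h : P.block i = P.block j) : entry (X * Y) i j = 0 := by
  rw [entry_mul]
  refine Finset.sum_eq_zero fun k _ => ?_
  split_ifs with hs
  · rw [hY k j (by unfold Survives at hs; omega), mul_zero]
  · rfl

theorem entry_mul_eq_zero_right {X Y : ContractedAlgebra F P}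
    (hX : ∀ i j, P.block i = P.block j → entry X i j = 0) (i j : Label T n)
    (h : P.block i = P.block j) : entry (X * Y) i j = 0 := by
  rw [entry_mul]
  refine Finset.sum_eq_zero fun k _ => ?_
  split_ifs with hs
  · rw [hX i k (by unfold Survives at hs; omega), zero_mul]
  · rfl

/-- The action `g • X = g X g†` of `𝐆ᵃ` on `𝔲ᵃ`. -/
instance : MulAction (ContractedGL F P) (nilSpace F P) where
  smul g X := ⟨(g : ContractedAlgebra F P) * (X : ContractedAlgebra F P) *
      star (g : ContractedAlgebra F P),
    entry_mul_eq_zero_right (entry_mul_eq_zero_left X.2.1), by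
      rw [star_mul, star_mul, star_star, X.2.2, neg_mul, mul_neg, mul_assoc]⟩
  one_smul X := Subtype.ext (by
    change (1 : ContractedAlgebra F P) * X * star (1 : ContractedAlgebra F P) = X
    simp)
  mul_smul g h X := Subtype.ext (by
    change (g * h : ContractedAlgebra F P) * X * star (g * h : ContractedAlgebra F P) =
      g * (h * X * star (h : ContractedAlgebra F P)) * star (g : ContractedAlgebra F P)
    simp only [star_mul, mul_assoc])

end Algebra

section Roots

variable {T : Series} {n : ℕ}

/-- Pairs attached to positive roots: `(i, j)` to `ε_i - ε_j` and `(i, -j)` to `ε_i + ε_j` for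
`i > j > 0`; `(i, 0)` to `ε_i` in the series `B`; `(i, -i)` to `2 ε_i` in the series `C`. -/
def IsPosRoot (α : Label T n × Label T n) : Prop :=
  0 < α.1.1 ∧ ((0 < α.2.1 ∧ α.2.1 < α.1.1) ∨ (α.2.1 < 0 ∧ -α.2.1 < α.1.1) ∨
    (T = Series.B ∧ α.2.1 = 0) ∨ (T = Series.C ∧ α.2.1 = -α.1.1))

/-- Pairs attached to roots; the pair of `-α` is the transpose of the pair of `α`. -/
def IsRoot (α : Label T n × Label T n) : Prop := IsPosRoot α ∨ IsPosRoot α.swap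

/-- `α = (i, j) ↦ α' = (-j, -i)`. -/
def primed (α : Label T n × Label T n) : Label T n × Label T n := (opp α.2, opp α.1)

/-- The union `D ∪ D'`. -/
def symmetrized (D : Finset (Label T n × Label T n)) : Finset (Label T n × Label T n) :=
  D ∪ D.image primed

/-- `D` is a rook placement in the set `Δ(𝔲ᵃ)` of the roots lying outside the diagonal blocks:
there is at most one pair of `D ∪ D'` in any row and in any column. -/
structure IsRookPlacement (P : SymPartition T n) (D : Finset (Label T n × Label T n)) : Prop where
  isRoot : ∀ γ ∈ D, IsRoot γ
  block_ne : ∀ γ ∈ D, P.block γ.1 ≠ P.block γ.2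
  row : ∀ α ∈ symmetrized D, ∀ β ∈ symmetrized D, α.1 = β.1 → α = β
  col : ∀ α ∈ symmetrized D, ∀ β ∈ symmetrized D, α.2 = β.2 → α = β

/-- `γ` belongs to `I_k × I_m`. -/
def InBlock (P : SymPartition T n) (k m : ℤ) (γ : Label T n × Label T n) : Prop :=
  P.block γ.1 = k ∧ P.block γ.2 = m

instance (P : SymPartition T n) (k m : ℤ) : DecidablePred (InBlock P k m) :=
  fun _ => by unfold InBlock; infer_instance

/-- `r_{km}(D) = |(D ∪ D') ∩ (I_k × I_m)|`. -/
def blockRank (P : SymPartition T n) (D : Finset (Label T n × Label T n)) (k m : ℤ) : ℕ :=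
  ((symmetrized D).filter (InBlock P k m)).card

variable {F : Type*} [Field F]

/-- `(D, φ)` is a basic pair. -/
def IsBasicPair (P : SymPartition T n) (δ : F) (D : Finset (Label T n × Label T n))
    (φ : D → Fˣ) : Prop :=
  IsRookPlacement P D ∧
  (T ≠ Series.C → ∀ γ : D, φ γ = 1) ∧
  (T = Series.C →
    (∀ γ : D, (φ γ : F) = 1 ∨ (φ γ : F) = δ) ∧
    (∀ γ : D, (φ γ : F) = δ → γ.1.2 = opp γ.1.1) ∧
    (∀ k : ℤ,
      (∀ γ : D, InBlock P k (-k) γ.1 → γ.1.2 = opp γ.1.1) ∧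
      (∀ γ γ' : D, InBlock P k (-k) γ.1 → InBlock P k (-k) γ'.1 →
        (φ γ : F) = δ → (φ γ' : F) = δ → γ = γ')))

open Classical in
/-- `d_k(φ)` is `-1` if there is a root `γ ∈ D ∩ (I_k × I_{-k})` with `φ(γ) = δ`, and `1`
otherwise. -/
def blockSign (P : SymPartition T n) (δ : F) (D : Finset (Label T n × Label T n))
    (φ : D → Fˣ) (k : ℤ) : ℤ :=
  if ∃ γ : D, InBlock P k (-k) γ.1 ∧ (φ γ : F) = δ then -1 else 1

variable (F) in
/-- The coefficient `η(α) ∈ {1, 0, -1}` for which `E_α + η(α) E_{α'}` satisfies `X† = -X`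
(with `η(α) = 0` when `α' = α`). -/
def eta (α : Label T n × Label T n) : F :=
  if primed α = α then 0 else -(sgn F T α.1 * sgn F T α.2)

/-- The matrix unit in position `α` (it is `E_α` above and `F_α` below the diagonal). -/
def unitAt (P : SymPartition T n) (F : Type*) [Field F] (α : Label T n × Label T n) :
    ContractedAlgebra F P :=
  (Matrix.single α.1 α.2 1 : Matrix (Label T n) (Label T n) F)

/-- The root vector `E_α + η(α) E_{α'}` for `α > 0`, or `F_α + η(α) F_{α'}` for `α < 0`. -/
def rootVector (P : SymPartition T n) (F : Type*) [Field F] (α : Label T n × Label T n) :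
    ContractedAlgebra F P :=
  unitAt P F α + eta F α • unitAt P F (primed α)

theorem entry_unitAt (P : SymPartition T n) (α : Label T n × Label T n) (i j : Label T n) :
    entry (unitAt P F α) i j = if α.1 = i ∧ α.2 = j then 1 else 0 := by
  simp [entry, unitAt, Matrix.single_apply]

theorem opp_eq_iff (i j : Label T n) : i = opp j ↔ opp i = j := by
  constructor
  · rintro rfl; simp
  · rintro rfl; simp

theorem rootVector_mem (P : SymPartition T n) {α : Label T n × Label T n}
    (hα : IsRoot α) (hb : P.block α.1 ≠ P.block α.2) : rootVector P F α ∈ nilSpace F P := by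
  obtain ⟨a, b⟩ := α
  constructor
  · intro i j hij
    simp only [rootVector, entry_add, entry_smul, entry_unitAt, primed]
    rw [if_neg, if_neg]
    · simp
    · rintro ⟨rfl, rfl⟩
      rw [P.block_opp, P.block_opp] at hij
      exact hb (neg_injective hij).symm
    · rintro ⟨rfl, rfl⟩
      exact hb hij
  · ext i j
    simp only [rootVector, entry_star, entry_neg, entry_add, entry_smul, entry_unitAt, primed,
      eta, Prod.mk.injEq]
    by_cases h : opp b = a
    · have h' : opp a = b := by rw [← h]; simp
      have hs : sgn F T a * sgn F T b = -1 := by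
        have hab : b.1 = -a.1 := by rw [← h']; rfl
        have h0 : T = Series.C ∧ a.1 ≠ 0 := by
          simp only [IsRoot, IsPosRoot, Prod.swap] at hα
          by_cases hC : T = Series.C
          · exact ⟨hC, by omega⟩
          · simp only [hC, false_and, or_false] at hα
            omega
        unfold sgn
        simp only [h0.1, true_and]
        split_ifs <;> first | omega | simp
      simp only [h, h', and_self, if_true, zero_mul, add_zero]
      by_cases hc : a = i ∧ b = j
      · obtain ⟨rfl, rfl⟩ := hc
        rw [if_pos ⟨h.symm, h'.symm⟩, hs]
        simp
      · rw [if_neg hc, if_neg]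
        · simp
        · rintro ⟨h1, h2⟩
          rw [opp_eq_iff, h'] at h1
          rw [opp_eq_iff, h] at h2
          exact hc ⟨h2, h1⟩
    · have h' : ¬(opp b = a ∧ opp a = b) := fun e => h e.1
      simp only [h', if_false]
      have e1 : (a = opp j ∧ b = opp i) ↔ (opp b = i ∧ opp a = j) := by
        rw [opp_eq_iff, opp_eq_iff]; tauto
      have e2 : (opp b = opp j ∧ opp a = opp i) ↔ (a = i ∧ b = j) := by
        rw [← opp_eq_iff, ← opp_eq_iff, opp_opp, opp_opp]; tauto
      simp only [e1, e2]
      by_cases hc : a = i ∧ b = j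
      · obtain ⟨rfl, rfl⟩ := hc
        simp only [h, false_and, if_false, and_self, if_true]
        linear_combination (-(sgn F T b * sgn F T b)) * sgn_mul_self (F := F) a -
          sgn_mul_self (F := F) b
      · by_cases hd : opp b = i ∧ opp a = j
        · obtain ⟨rfl, rfl⟩ := hd
          simp only [hc, if_false, and_self, if_true]
          rw [sgn_opp_mul]
          ring
        · simp [hc, hd]

/-- The element `𝒳_{D,φ} = ∑_{γ ∈ D₊} φ(γ) ℰ_γ + ∑_{γ ∈ D₋} φ(γ) ℱ_γ` of `𝔲ᵃ`. -/
def basicElement (P : SymPartition T n) (D : Finset (Label T n × Label T n))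
    (hD : IsRookPlacement P D) (φ : D → Fˣ) : nilSpace F P :=
  ∑ γ : D, (φ γ : F) •
    (⟨rootVector P F γ.1, rootVector_mem P (hD.isRoot _ γ.2) (hD.block_ne _ γ.2)⟩ : nilSpace F P)

end Roots

end ParabolicContraction

end

noncomputable section

namespace ParabolicContraction

variable {F : Type*} [Field F] {T : Series} {n : ℕ} {P : SymPartition T n}

/-! Arrange the blocks on a circle in decreasing order and read the position `(a, c)` as the arc
from `a` downwards to `c`, through the last block and back to the first one when `a < c`. `Survives
a b c` says that the arcs `a → b` and `b → c` concatenate to the arc `a → c`, without a full turn.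
Hence, cut down to an interval of the circle, the contracted product becomes the usual product of
matrices, block triangular along that interval (`restrict_mul`), and the action `g X g†` becomes a
genuine product of three matrices.

Ranks. A restricted `𝒳_{D,φ}` has at most one nonzero entry in each row and column, so its rank is
the number of pairs of `D ∪ D'` inside the interval, and this number is constant on orbits
(`card_rooksIn_eq`). Inclusion–exclusion over the intervals obtained by dropping an end block
isolates each `r_{km}`.

Signs. On an interval stable under `(a, b) ↦ (-b, -a)`, the rows and columns met by the rooks give
square submatrices, and that of `g†` is, up to signs, the transpose of that of `g` with its indices
permuted. Taking determinants, the product of the entries changes by a square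
(`exists_prod_entry_eq`). Two nested symmetric intervals that differ, among the blocks `I_a ×
I_{-a}` with `a ≠ 0`, only at `a = k` show that `d_k` is invariant, since `δ` is not a square. This
compares two coefficient functions on one placement; different placements are first brought together
by the construction below.

Conversely, equal invariants give a bijection of the placements that respects blocks and
coefficients. It induces a partial bijection of labels inside the blocks, which extends to a
permutation; the corresponding block diagonal monomial matrix, with suitable signs, carries one
element to the other (`PreservesBlocks.mem_orbit`). -/

theorem opp_injective : Function.Injective (opp : Label T n → Label T n) :=
  (oppEquiv T n).injective

@[simp] theorem primed_primed (α : Label T n × Label T n) : primed (primed α) = α := by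
  simp [primed]

theorem primed_eq_self_iff {α : Label T n × Label T n} : primed α = α ↔ α.2 = opp α.1 := by
  obtain ⟨a, b⟩ := α
  simp only [primed, Prod.mk.injEq]
  constructor
  · exact fun h => h.2.symm
  · rintro rfl
    simp

theorem sgn_ne_zero (i : Label T n) : sgn F T i ≠ 0 := fun h => by
  simpa [h] using sgn_mul_self (F := F) i

theorem eta_ne_zero {α : Label T n × Label T n} (h : primed α ≠ α) : eta F α ≠ 0 := by
  simp [eta, h, sgn_ne_zero]

theorem IsRoot.add_nonneg {α : Label T n × Label T n} (h : IsRoot α) : 0 ≤ α.1.1 + α.2.1 := by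
  rcases h with h | h <;> simp only [IsPosRoot, Prod.swap] at h <;> omega

/-- The sum of the two labels is nonnegative for a root and changes sign under `primed`, so it
vanishes when both pairs are roots. Thus `D` meets each orbit of `primed` at most once. -/
theorem IsRoot.primed_eq {α : Label T n × Label T n} (h : IsRoot α) (h' : IsRoot (primed α)) :
    primed α = α := by
  have h1 := h.add_nonneg
  have h2 := h'.add_nonneg
  rw [primed_eq_self_iff]
  apply Subtype.ext
  simp only [primed, opp_val] at h2 ⊢
  omega

theorem IsRoot.eq_C {α : Label T n × Label T n} (h : IsRoot α) (h' : primed α = α) :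
    T = Series.C := by
  rw [primed_eq_self_iff] at h'
  have h2 : α.2.1 = -α.1.1 := by rw [h']; rfl
  by_contra hC
  rcases h with h | h <;> simp only [IsPosRoot, Prod.swap, hC, false_and, or_false] at h <;> omega

theorem mem_symmetrized {D : Finset (Label T n × Label T n)} {α : Label T n × Label T n} :
    α ∈ symmetrized D ↔ α ∈ D ∨ primed α ∈ D := by
  simp only [symmetrized, Finset.mem_union, Finset.mem_image]
  constructor
  · rintro (h | ⟨β, h, rfl⟩)
    · exact Or.inl h
    · exact Or.inr (by simpa using h)
  · rintro (h | h)
    · exact Or.inl h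
    · exact Or.inr ⟨_, h, by simp⟩

theorem primed_mem_symmetrized {D : Finset (Label T n × Label T n)} {α : Label T n × Label T n}
    (h : α ∈ symmetrized D) : primed α ∈ symmetrized D := by
  rw [mem_symmetrized] at *
  rw [primed_primed]
  exact h.symm

/-! ### Entries of the elements `𝒳_{D,φ}` -/

section Entries

variable {D : Finset (Label T n × Label T n)} (hD : IsRookPlacement P D) (φ : D → Fˣ)

theorem coe_basicElement : (basicElement P D hD φ : ContractedAlgebra F P) =
    ∑ γ : D, (φ γ : F) • rootVector P F γ.1 := by
  simp [basicElement]

theorem entry_sum {ι : Type*} (s : Finset ι) (f : ι → ContractedAlgebra F P) (i j : Label T n) :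
    entry (∑ x ∈ s, f x) i j = ∑ x ∈ s, entry (f x) i j := by
  classical
  induction s using Finset.induction_on with
  | empty => simp
  | insert a s ha ih => rw [Finset.sum_insert ha, Finset.sum_insert ha, entry_add, ih]

theorem entry_rootVector (α β : Label T n × Label T n) :
    entry (rootVector P F α) β.1 β.2 =
      (if α = β then 1 else 0) + eta F α * if primed α = β then 1 else 0 := by
  simp only [rootVector, entry_add, entry_smul, entry_unitAt, Prod.ext_iff]

theorem entry_basicElement (β : Label T n × Label T n) :
    entry (basicElement P D hD φ : ContractedAlgebra F P) β.1 β.2 =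
      ∑ γ : D, (φ γ : F) *
        ((if γ.1 = β then 1 else 0) + eta F γ.1 * if primed γ.1 = β then 1 else 0) := by
  rw [coe_basicElement, entry_sum]
  simp only [entry_smul, entry_rootVector]

theorem entry_basicElement_of_mem (γ : D) :
    entry (basicElement P D hD φ : ContractedAlgebra F P) γ.1.1 γ.1.2 = φ γ := by
  rw [entry_basicElement, Finset.sum_eq_single γ]
  · by_cases h : primed γ.1 = γ.1 <;> simp [h, eta]
  · intro β _ hβ
    have h1 : β.1 ≠ γ.1 := fun h => hβ (Subtype.ext h)
    -- Otherwise `β` and its image under `primed` are both roots, so they coincide and `β = γ`.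
    have h2 : primed β.1 ≠ γ.1 := fun h => h1 <| by
      rw [← (hD.isRoot _ β.2).primed_eq (by rw [h]; exact hD.isRoot _ γ.2), h]
    simp [h1, h2]
  · simp

theorem entry_basicElement_primed (γ : D) (hγ : primed γ.1 ≠ γ.1) :
    entry (basicElement P D hD φ : ContractedAlgebra F P) (primed γ.1).1 (primed γ.1).2 =
      φ γ * eta F γ.1 := by
  rw [entry_basicElement, Finset.sum_eq_single γ]
  · simp [hγ.symm]
  · intro β _ hβ
    have h1 : primed β.1 ≠ primed γ.1 := fun h => hβ <| Subtype.ext <| by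
      rw [← primed_primed β.1, h, primed_primed]
    have h2 : β.1 ≠ primed γ.1 := fun h =>
      hγ ((hD.isRoot _ γ.2).primed_eq (by rw [← h]; exact hD.isRoot _ β.2))
    simp [h1, h2]
  · simp

theorem entry_basicElement_ne_zero_iff (β : Label T n × Label T n) :
    entry (basicElement P D hD φ : ContractedAlgebra F P) β.1 β.2 ≠ 0 ↔ β ∈ symmetrized D := by
  constructor
  · intro h
    by_contra hβ
    refine h ?_
    rw [entry_basicElement]
    refine Finset.sum_eq_zero fun γ _ => ?_
    rw [mem_symmetrized, not_or] at hβ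
    have h1 : γ.1 ≠ β := fun h => hβ.1 (h ▸ γ.2)
    have h2 : primed γ.1 ≠ β := fun h => hβ.2 (by rw [← h, primed_primed]; exact γ.2)
    simp [h1, h2]
  · intro h
    by_cases h0 : β ∈ D
    · rw [entry_basicElement_of_mem hD φ ⟨β, h0⟩]
      exact Units.ne_zero _
    · have h1 : primed β ∈ D := (mem_symmetrized.1 h).resolve_left h0
      have h2 : primed (primed β) ≠ primed β := by
        rw [primed_primed]
        exact fun h => h0 (h ▸ h1)
      have := entry_basicElement_primed hD φ ⟨_, h1⟩ h2
      simp only [primed_primed] at this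
      rw [this]
      exact mul_ne_zero (Units.ne_zero _) (eta_ne_zero h2)

end Entries

/-! ### Restriction to intervals of the cyclic order of blocks -/

/-- The relation `C a b` on blocks says that `a` precedes `b` in an interval of the cyclic order.
This property makes the restriction of matrices to `C` multiplicative. -/
def IsInterval (C : ℤ → ℤ → Prop) : Prop :=
  ∀ a b c, C a b ∧ C b c ↔ C a c ∧ Survives a b c

/-- The interval from `p` down to `q`. -/
def Straight (p q a b : ℤ) : Prop := a ≤ p ∧ b ≤ a ∧ q ≤ b

/-- The interval that goes from `p` down to the last block and then from the first block down
to `q`. -/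
def Wrapped (p q a b : ℤ) : Prop := (b ≤ a ∧ a ≤ p) ∨ (q ≤ b ∧ b ≤ a) ∨ (a ≤ p ∧ q ≤ b)

instance (p q : ℤ) : DecidableRel (Straight p q) :=
  fun _ _ => by unfold Straight; infer_instance

instance (p q : ℤ) : DecidableRel (Wrapped p q) :=
  fun _ _ => by unfold Wrapped; infer_instance

theorem isInterval_straight (p q : ℤ) : IsInterval (Straight p q) := by
  intro a b c
  unfold Straight Survives
  omega

/-- The condition `p < q` keeps the two ends of the arc from overlapping, so the arc is linearly
ordered. -/
theorem isInterval_wrapped {p q : ℤ} (h : p < q) : IsInterval (Wrapped p q) := by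
  intro a b c
  unfold Wrapped Survives
  omega

section Restrict

variable {C : ℤ → ℤ → Prop} [DecidableRel C]

/-- The entries in the blocks related by `C`. -/
def restrict (C : ℤ → ℤ → Prop) [DecidableRel C] (X : ContractedAlgebra F P) :
    Matrix (Label T n) (Label T n) F :=
  Matrix.of fun i j => if C (P.block i) (P.block j) then entry X i j else 0

/-- The two directions of `IsInterval` say that the terms kept by the contracted product inside `C`
are exactly those with both factors inside `C`. -/
theorem restrict_mul (hC : IsInterval C) (X Y : ContractedAlgebra F P) :
    restrict C (X * Y) = restrict C X * restrict C Y := by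
  ext i j
  simp only [restrict, Matrix.of_apply, Matrix.mul_apply, entry_mul]
  split_ifs with h
  · refine Finset.sum_congr rfl fun k _ => ?_
    have := hC (P.block i) (P.block k) (P.block j)
    by_cases hs : Survives (P.block i) (P.block k) (P.block j)
    · obtain ⟨h1, h2⟩ := this.2 ⟨h, hs⟩
      simp [hs, h1, h2]
    · have h3 : ¬(C (P.block i) (P.block k) ∧ C (P.block k) (P.block j)) := fun e =>
        hs (this.1 e).2
      rw [if_neg hs]
      split_ifs <;> simp_all
  · refine (Finset.sum_eq_zero fun k _ => ?_).symm
    have h3 : ¬(C (P.block i) (P.block k) ∧ C (P.block k) (P.block j)) := fun e =>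
      h ((hC _ _ _).1 e).1
    split_ifs <;> simp_all

/-- The pairs of `D ∪ D'` in the blocks related by `C`. -/
def rooksIn (P : SymPartition T n) (C : ℤ → ℤ → Prop) [DecidableRel C]
    (D : Finset (Label T n × Label T n)) : Finset (Label T n × Label T n) :=
  (symmetrized D).filter fun γ => C (P.block γ.1) (P.block γ.2)

theorem mem_rooksIn {D : Finset (Label T n × Label T n)} {γ : Label T n × Label T n} :
    γ ∈ rooksIn P C D ↔ γ ∈ symmetrized D ∧ C (P.block γ.1) (P.block γ.2) := by
  simp [rooksIn]

theorem restrict_basicElement_ne_zero_iff {D : Finset (Label T n × Label T n)}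
    (hD : IsRookPlacement P D) (φ : D → Fˣ) (i j : Label T n) :
    restrict C (basicElement P D hD φ : ContractedAlgebra F P) i j ≠ 0 ↔
      (i, j) ∈ rooksIn P C D := by
  rw [mem_rooksIn, ← entry_basicElement_ne_zero_iff hD φ (i, j)]
  simp only [restrict, Matrix.of_apply]
  split_ifs with h <;> simp [h]

end Restrict

/-! ### Matrices with at most one nonzero entry in any row and column -/

section Rook

variable {ι κ : Type*} [DecidableEq ι] [DecidableEq κ]

theorem submatrix_eq_diagonal {M : Matrix ι κ F} {S : Finset (ι × κ)}
    (hM : ∀ i j, M i j ≠ 0 ↔ (i, j) ∈ S)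
    (hrow : ∀ α ∈ S, ∀ β ∈ S, α.1 = β.1 → α = β)
    (hcol : ∀ α ∈ S, ∀ β ∈ S, α.2 = β.2 → α = β) :
    M.submatrix (fun s : S => s.1.1) (fun s : S => s.1.2) =
      Matrix.diagonal fun s : S => M s.1.1 s.1.2 := by
  ext s t
  by_cases h : s = t
  · subst h
    simp
  · rw [Matrix.diagonal_apply_ne _ h]
    by_contra h0
    have hm := (hM _ _).1 h0
    exact h (Subtype.ext ((hrow _ hm _ s.2 rfl).symm.trans (hcol _ hm _ t.2 rfl)))

variable [Fintype ι] [Fintype κ]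

/-- Writing `M` as a combination of the matrix units in `S` factors every submatrix of `g * M * h`
through the index set `S`. This serves both the rank bound and the determinant computation. -/
theorem submatrix_mul_mul {M : Matrix ι κ F} {S : Finset (ι × κ)}
    (hM : ∀ i j, M i j ≠ 0 → (i, j) ∈ S) (g : Matrix ι ι F) (h : Matrix κ κ F)
    {ρ σ : Type*} (r : ρ → ι) (c : σ → κ) :
    (g * M * h).submatrix r c = g.submatrix r (fun s : S => s.1.1) *
      (Matrix.diagonal (fun s : S => M s.1.1 s.1.2) * h.submatrix (fun s : S => s.1.2) c) := by
  ext x y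
  rw [Matrix.submatrix_apply, Matrix.mul_apply, Matrix.mul_apply]
  simp only [Matrix.diagonal_mul, Matrix.submatrix_apply]
  simp only [Matrix.mul_apply, Finset.sum_mul]
  rw [Finset.sum_comm, ← Finset.sum_product',
    Finset.sum_coe_sort S fun s => g (r x) s.1 * (M s.1 s.2 * h s.2 (c y))]
  symm
  refine Finset.sum_subset_zero_on_sdiff (fun _ _ => by simp) (fun s hs => ?_)
    (fun s _ => by ring)
  have : M s.1 s.2 = 0 := by
    by_contra h0
    exact (Finset.mem_sdiff.1 hs).2 (hM _ _ h0)
  simp [this]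

/-- The submatrix of `N` on the rows and columns of `R` is an invertible diagonal matrix, hence of
rank `|R|`, and it factors through a space of dimension `|S|`. Neither `g` nor `h` has to be
invertible: a restricted group element is zero outside the interval. -/
theorem card_le_of_eq_mul_mul {M N : Matrix ι κ F} {S R : Finset (ι × κ)}
    (hM : ∀ i j, M i j ≠ 0 ↔ (i, j) ∈ S) (hN : ∀ i j, N i j ≠ 0 ↔ (i, j) ∈ R)
    (hrow : ∀ α ∈ R, ∀ β ∈ R, α.1 = β.1 → α = β)
    (hcol : ∀ α ∈ R, ∀ β ∈ R, α.2 = β.2 → α = β)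
    (g : Matrix ι ι F) (h : Matrix κ κ F) (e : N = g * M * h) : R.card ≤ S.card := by
  have h1 := submatrix_eq_diagonal hN hrow hcol
  have h2 : (Matrix.diagonal fun s : R => N s.1.1 s.1.2).rank = R.card := by
    rw [Matrix.rank_of_isUnit, Fintype.card_coe]
    rw [Matrix.isUnit_diagonal, Pi.isUnit_iff]
    exact fun s => ((hN _ _).2 s.2).isUnit
  rw [← h2, ← h1, e, submatrix_mul_mul fun i j => (hM i j).1]
  refine (Matrix.rank_mul_le_left _ _).trans ((Matrix.rank_le_card_width _).trans ?_)
  simp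

end Rook

/-! ### Invariance of the block ranks -/

theorem coe_smul_nilSpace (g : ContractedGL F P) (X : nilSpace F P) :
    ((g • X : nilSpace F P) : ContractedAlgebra F P) =
      (g : ContractedAlgebra F P) * X * star (g : ContractedAlgebra F P) := rfl

section Invariants

variable {D D' : Finset (Label T n × Label T n)} {hD : IsRookPlacement P D}
  {hD' : IsRookPlacement P D'} {φ : D → Fˣ} {φ' : D' → Fˣ}

theorem card_rooksIn_le (h : basicElement P D' hD' φ' ∈
      MulAction.orbit (ContractedGL F P) (basicElement P D hD φ))
    {C : ℤ → ℤ → Prop} [DecidableRel C] (hC : IsInterval C) :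
    (rooksIn P C D').card ≤ (rooksIn P C D).card := by
  obtain ⟨g, hg⟩ := h
  replace hg := congrArg (fun X : nilSpace F P => restrict C (X : ContractedAlgebra F P)) hg
  simp only [coe_smul_nilSpace, restrict_mul hC] at hg
  refine card_le_of_eq_mul_mul (restrict_basicElement_ne_zero_iff hD φ)
    (restrict_basicElement_ne_zero_iff hD' φ') ?_ ?_ _ _ hg.symm
  · exact fun α hα β hβ => hD'.row α (mem_rooksIn.1 hα).1 β (mem_rooksIn.1 hβ).1
  · exact fun α hα β hβ => hD'.col α (mem_rooksIn.1 hα).1 β (mem_rooksIn.1 hβ).1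

theorem card_rooksIn_eq (h : basicElement P D' hD' φ' ∈
      MulAction.orbit (ContractedGL F P) (basicElement P D hD φ))
    {C : ℤ → ℤ → Prop} [DecidableRel C] (hC : IsInterval C) :
    (rooksIn P C D).card = (rooksIn P C D').card :=
  le_antisymm (card_rooksIn_le (MulAction.mem_orbit_symm.1 h) hC) (card_rooksIn_le h hC)

/-- Inclusion–exclusion: the pairs that survive neither the removal of the first block `p` nor that
of the last block `q` are those of `I_p × I_q`. -/
theorem blockRank_add_straight (D : Finset (Label T n × Label T n)) {p q : ℤ} (h : q ≤ p) :
    blockRank P D p q + (rooksIn P (Straight (p - 1) q) D).card +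
        (rooksIn P (Straight p (q + 1)) D).card =
      (rooksIn P (Straight p q) D).card + (rooksIn P (Straight (p - 1) (q + 1)) D).card := by
  simp only [blockRank, rooksIn, Finset.card_filter, ← Finset.sum_add_distrib]
  refine Finset.sum_congr rfl fun γ _ => ?_
  by_cases h0 : InBlock P p q γ <;>
  by_cases h1 : Straight (p - 1) q (P.block γ.1) (P.block γ.2) <;>
  by_cases h2 : Straight p (q + 1) (P.block γ.1) (P.block γ.2) <;>
  by_cases h3 : Straight p q (P.block γ.1) (P.block γ.2) <;>
  by_cases h4 : Straight (p - 1) (q + 1) (P.block γ.1) (P.block γ.2) <;>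
  simp only [h0, h1, h2, h3, h4, if_true, if_false] <;>
  unfold InBlock at h0 <;> unfold Straight at h1 h2 h3 h4 <;> omega

theorem blockRank_add_wrapped (D : Finset (Label T n × Label T n)) {p q : ℤ} (h : p < q) :
    blockRank P D p q + (rooksIn P (Wrapped (p - 1) q) D).card +
        (rooksIn P (Wrapped p (q + 1)) D).card =
      (rooksIn P (Wrapped p q) D).card + (rooksIn P (Wrapped (p - 1) (q + 1)) D).card := by
  simp only [blockRank, rooksIn, Finset.card_filter, ← Finset.sum_add_distrib]
  refine Finset.sum_congr rfl fun γ _ => ?_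
  by_cases h0 : InBlock P p q γ <;>
  by_cases h1 : Wrapped (p - 1) q (P.block γ.1) (P.block γ.2) <;>
  by_cases h2 : Wrapped p (q + 1) (P.block γ.1) (P.block γ.2) <;>
  by_cases h3 : Wrapped p q (P.block γ.1) (P.block γ.2) <;>
  by_cases h4 : Wrapped (p - 1) (q + 1) (P.block γ.1) (P.block γ.2) <;>
  simp only [h0, h1, h2, h3, h4, if_true, if_false] <;>
  unfold InBlock at h0 <;> unfold Wrapped at h1 h2 h3 h4 <;> omega

theorem blockRank_eq_of_mem_orbit (h : basicElement P D' hD' φ' ∈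
      MulAction.orbit (ContractedGL F P) (basicElement P D hD φ)) (k m : ℤ) :
    blockRank P D k m = blockRank P D' k m := by
  rcases le_or_gt m k with hkm | hkm
  · have h1 := blockRank_add_straight (P := P) D hkm
    have h2 := blockRank_add_straight (P := P) D' hkm
    have e := fun p q => card_rooksIn_eq h (isInterval_straight p q)
    simp only [e] at h1
    omega
  · have h1 := blockRank_add_wrapped (P := P) D hkm
    have h2 := blockRank_add_wrapped (P := P) D' hkm
    have e1 := card_rooksIn_eq h (isInterval_wrapped hkm)
    have e2 := card_rooksIn_eq h (isInterval_wrapped (show k - 1 < m by omega))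
    have e3 := card_rooksIn_eq h (isInterval_wrapped (show k < m + 1 by omega))
    have e4 := card_rooksIn_eq h (isInterval_wrapped (show k - 1 < m + 1 by omega))
    omega

end Invariants

/-! ### Extending partial bijections to permutations within blocks -/

theorem exists_perm_of_equiv {α β : Type*} [Finite α] (b : α → β) {p q : α → Prop}
    (e : {x // p x} ≃ {x // q x}) (he : ∀ x, b (e x) = b x) :
    ∃ w : Equiv.Perm α, (∀ x, b (w x) = b x) ∧ ∀ x (hx : p x), w x = e ⟨x, hx⟩ := by
  classical
  have he' : ∀ x, b (e.symm x) = b x := fun x => by rw [← he, e.apply_symm_apply]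
  -- By finiteness a partial bijection of one fibre of `b` extends to a permutation of that fibre;
  -- the extensions are then glued over all fibres.
  let ec (c : β) : {y : {x // b x = c} // p y} ≃ {y : {x // b x = c} // q y} :=
    { toFun := fun y => ⟨⟨e ⟨y.1.1, y.2⟩, (he _).trans y.1.2⟩, (e ⟨y.1.1, y.2⟩).2⟩
      invFun := fun y => ⟨⟨e.symm ⟨y.1.1, y.2⟩, (he' _).trans y.1.2⟩, (e.symm ⟨y.1.1, y.2⟩).2⟩
      left_inv := fun y => by ext; simp
      right_inv := fun y => by ext; simp }
  refine ⟨Equiv.ofFiberEquiv (f := b) (g := b) fun c => (ec c).extendSubtype,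
    fun x => Equiv.ofFiberEquiv_map _ x, fun x hx => ?_⟩
  change (((ec (b x)).extendSubtype ⟨x, rfl⟩ : {y // b y = b x}) : α) = _
  rw [Equiv.extendSubtype_apply_of_mem (ec (b x)) ⟨x, rfl⟩ hx]
  rfl

theorem exists_perm_of_rel {α β : Type*} [Finite α] (b : α → β) (R : α → α → Prop)
    (hb : ∀ i j, R i j → b j = b i) (h1 : ∀ i j j', R i j → R i j' → j = j')
    (h2 : ∀ i i' j, R i j → R i' j → i = i') :
    ∃ w : Equiv.Perm α, (∀ x, b (w x) = b x) ∧ ∀ i j, R i j → w i = j := by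
  let e : {i // ∃ j, R i j} ≃ {j // ∃ i, R i j} :=
    { toFun := fun x => ⟨x.2.choose, x.1, x.2.choose_spec⟩
      invFun := fun y => ⟨y.2.choose, y.1, y.2.choose_spec⟩
      left_inv := fun x => Subtype.ext <| h2 _ _ x.2.choose
        (Exists.choose_spec (p := fun i => R i x.2.choose) _) x.2.choose_spec
      right_inv := fun y => Subtype.ext <| h1 y.2.choose _ _
        (Exists.choose_spec (p := fun j => R y.2.choose j) _) y.2.choose_spec }
  obtain ⟨w, hw, hw'⟩ := exists_perm_of_equiv b e fun x => hb _ _ x.2.choose_spec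
  refine ⟨w, hw, fun i j hij => ?_⟩
  rw [hw' i ⟨j, hij⟩]
  exact h1 i _ _ (Exists.choose_spec (p := fun j => R i j) _) hij

instance : IsScalarTower F (ContractedAlgebra F P) (ContractedAlgebra F P) where
  smul_assoc a X Y := by
    ext i j
    simp only [smul_eq_mul, entry_smul, entry_mul, Finset.mul_sum]
    refine Finset.sum_congr rfl fun k _ => ?_
    split_ifs <;> ring

instance : SMulCommClass F (ContractedAlgebra F P) (ContractedAlgebra F P) where
  smul_comm a X Y := by
    ext i j
    simp only [smul_eq_mul, entry_smul, entry_mul, Finset.mul_sum]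
    refine Finset.sum_congr rfl fun k _ => ?_
    split_ifs <;> ring

/-! ### Moving rook placements by monomial matrices -/

section Transport

variable {D D' : Finset (Label T n × Label T n)}

theorem IsRookPlacement.eq_of_row (hD : IsRookPlacement P D) {γ β : D}
    (h : γ.1.1 = β.1.1) : γ = β :=
  Subtype.ext (hD.row _ (mem_symmetrized.2 (Or.inl γ.2)) _ (mem_symmetrized.2 (Or.inl β.2)) h)

theorem IsRookPlacement.eq_of_col (hD : IsRookPlacement P D) {γ β : D}
    (h : γ.1.2 = β.1.2) : γ = β :=
  Subtype.ext (hD.col _ (mem_symmetrized.2 (Or.inl γ.2)) _ (mem_symmetrized.2 (Or.inl β.2)) h)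

/-- The row `-j` of the pair `primed (i, j)` can be the row of a root of `D` only when that root is
`(i, j)` itself and is antidiagonal. This is the only overlap between rows of `D` and of `D'`. -/
theorem IsRookPlacement.eq_of_row_opp (hD : IsRookPlacement P D) {γ β : D}
    (h : γ.1.1 = opp β.1.2) : γ = β ∧ primed β.1 = β.1 := by
  have h1 : γ.1 = primed β.1 := hD.row _ (mem_symmetrized.2 (Or.inl γ.2)) _
    (primed_mem_symmetrized (mem_symmetrized.2 (Or.inl β.2))) h
  have h2 : primed β.1 = β.1 :=
    (hD.isRoot _ β.2).primed_eq (by rw [← h1]; exact hD.isRoot _ γ.2)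
  exact ⟨Subtype.ext (h1.trans h2), h2⟩

/-- A bijection of rook placements, as a relation on labels: every root of the first placement
gives a pair of its rows in the symmetrized placement. -/
def LabelRel (f : D → D') (i j : Label T n) : Prop :=
  ∃ γ : D, (i = γ.1.1 ∧ j = (f γ).1.1) ∨ (i = opp γ.1.2 ∧ j = opp (f γ).1.2)

theorem LabelRel.unique (hD : IsRookPlacement P D) {f : D → D'}
    (hf : ∀ γ, primed γ.1 = γ.1 → primed (f γ).1 = (f γ).1) {i j j' : Label T n}
    (h : LabelRel f i j) (h' : LabelRel f i j') : j = j' := by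
  -- In the two mixed cases the root is antidiagonal, and so is its image; hence the two recipes for
  -- `j` agree.
  obtain ⟨γ, ⟨rfl, rfl⟩ | ⟨rfl, rfl⟩⟩ := h <;> obtain ⟨β, ⟨hi, rfl⟩ | ⟨hi, rfl⟩⟩ := h'
  · rw [hD.eq_of_row hi]
  · obtain ⟨rfl, h2⟩ := hD.eq_of_row_opp hi
    exact (congrArg Prod.fst (hf _ h2)).symm
  · obtain ⟨rfl, h2⟩ := hD.eq_of_row_opp hi.symm
    exact congrArg Prod.fst (hf _ h2)
  · rw [hD.eq_of_col (opp_injective hi)]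

theorem LabelRel.symm {f : D ≃ D'} {i j : Label T n} (h : LabelRel f i j) :
    LabelRel f.symm j i := by
  obtain ⟨γ, h⟩ := h
  exact ⟨f γ, by simpa [and_comm] using h⟩

/-- A bijection of rook placements that preserves blocks and antidiagonal pairs. -/
structure PreservesBlocks (P : SymPartition T n) (f : D ≃ D') : Prop where
  fst : ∀ γ, P.block (f γ).1.1 = P.block γ.1.1
  snd : ∀ γ, P.block (f γ).1.2 = P.block γ.1.2
  primed_iff : ∀ γ, primed (f γ).1 = (f γ).1 ↔ primed γ.1 = γ.1

theorem PreservesBlocks.exists_perm (hD : IsRookPlacement P D) (hD' : IsRookPlacement P D')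
    {f : D ≃ D'} (hf : PreservesBlocks P f) :
    ∃ w : Equiv.Perm (Label T n), (∀ i, P.block (w i) = P.block i) ∧
      ∀ γ : D, w γ.1.1 = (f γ).1.1 ∧ w (opp γ.1.2) = opp (f γ).1.2 := by
  obtain ⟨w, hw, hw'⟩ := exists_perm_of_rel P.block (LabelRel f) (fun i j h => by
      obtain ⟨γ, ⟨rfl, rfl⟩ | ⟨rfl, rfl⟩⟩ := h
      · exact hf.fst γ
      · rw [P.block_opp, P.block_opp, hf.snd])
    (fun i j j' => LabelRel.unique hD fun γ => (hf.primed_iff γ).2)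
    (fun i i' j h h' => LabelRel.unique hD' (fun γ hγ => by
      rw [← hf.primed_iff, f.apply_symm_apply]
      exact hγ) h.symm h'.symm)
  exact ⟨w, hw, fun γ => ⟨hw' _ _ ⟨γ, Or.inl ⟨rfl, rfl⟩⟩, hw' _ _ ⟨γ, Or.inr ⟨rfl, rfl⟩⟩⟩⟩

/-- The monomial matrix `∑ c_i E_{w(i), i}`. -/
def monomial (P : SymPartition T n) (w : Equiv.Perm (Label T n)) (c : Label T n → F) :
    ContractedAlgebra F P :=
  (Matrix.of fun i j => if i = w j then c j else 0 : Matrix (Label T n) (Label T n) F)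

theorem entry_monomial (w : Equiv.Perm (Label T n)) (c : Label T n → F) (i j : Label T n) :
    entry (monomial P w c) i j = if i = w j then c j else 0 := rfl

theorem survives_self_left (a b : ℤ) : Survives a a b := by unfold Survives; omega

theorem survives_self_right (a b : ℤ) : Survives a b b := by unfold Survives; omega

theorem monomial_mul_monomial_symm {w : Equiv.Perm (Label T n)} {c c' : Label T n → F}
    (hw : ∀ i, P.block (w i) = P.block i) (hc : ∀ i, c i * c' (w i) = 1) :
    monomial P w c * monomial P w.symm c' = 1 := by
  ext i j
  rw [entry_mul, entry_one, Finset.sum_eq_single (w.symm j)]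
  · have hj : P.block (w.symm j) = P.block j := by rw [← hw, w.apply_symm_apply]
    have h1 := hc (w.symm j)
    rw [w.apply_symm_apply] at h1
    simp [hj, survives_self_right, entry_monomial, h1]
  · intro k _ hk
    simp [entry_monomial, hk]
  · simp

/-- The monomial matrix as an element of the group. -/
def monomialUnit (w : Equiv.Perm (Label T n)) (hw : ∀ i, P.block (w i) = P.block i)
    (c : Label T n → Fˣ) : ContractedGL F P where
  val := monomial P w fun i => (c i : F)
  inv := monomial P w.symm fun i => ((c (w.symm i))⁻¹ : Fˣ)
  val_inv := monomial_mul_monomial_symm hw (by simp)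
  inv_val := by
    have hw' : ∀ i, P.block (w.symm i) = P.block i := fun i => by
      rw [← hw, w.apply_symm_apply]
    simpa using monomial_mul_monomial_symm (w := w.symm)
      (c := fun i => (((c (w.symm i))⁻¹ : Fˣ) : F)) (c' := fun i => (c i : F)) hw' (by simp)

theorem monomial_mul_unitAt {w : Equiv.Perm (Label T n)} (hw : ∀ i, P.block (w i) = P.block i)
    (c : Label T n → F) (i j : Label T n) :
    monomial P w c * unitAt P F (i, j) = c i • unitAt P F (w i, j) := by
  ext a b
  rw [entry_mul, Finset.sum_eq_single i]
  · by_cases ha : a = w i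
    · subst ha
      simp [hw, survives_self_left, entry_monomial, entry_unitAt]
    · simp [entry_monomial, entry_unitAt, ha, Ne.symm ha]
  · intro k _ hk
    simp [entry_unitAt, hk.symm]
  · simp

theorem unitAt_mul_star_monomial {w : Equiv.Perm (Label T n)}
    (hw : ∀ i, P.block (w i) = P.block i) (c : Label T n → F) (i j : Label T n) :
    unitAt P F (i, j) * star (monomial P w c) =
      (sgn F T j * sgn F T (opp (w (opp j))) * c (opp j)) •
        unitAt P F (i, opp (w (opp j))) := by
  ext a b
  rw [entry_mul, Finset.sum_eq_single j]
  · by_cases hb : b = opp (w (opp j))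
    · subst hb
      simp [hw, P.block_opp, survives_self_right, entry_monomial, entry_unitAt, entry_star]
    · have hb' : opp b ≠ w (opp j) := by rwa [Ne, ← opp_eq_iff]
      simp [entry_monomial, entry_unitAt, entry_star, Ne.symm hb, hb']
  · intro k _ hk
    simp [entry_unitAt, hk.symm]
  · simp

/-- The column `j` moves to `-w(-j)`, which is why `w` has to be prescribed on the rows `γ.1` and on
the negatives of the columns `γ.2`. -/
theorem monomial_mul_unitAt_mul_star {w : Equiv.Perm (Label T n)}
    (hw : ∀ i, P.block (w i) = P.block i) (c : Label T n → F) (i j : Label T n) :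
    monomial P w c * unitAt P F (i, j) * star (monomial P w c) =
      (c i * c (opp j) * (sgn F T j * sgn F T (opp (w (opp j))))) •
        unitAt P F (w i, opp (w (opp j))) := by
  rw [monomial_mul_unitAt hw, smul_mul_assoc, unitAt_mul_star_monomial hw, smul_smul]
  congr 1
  ring

theorem SymPartition.val_neg_iff {i : Label T n} (h : P.block i ≠ 0) :
    i.1 < 0 ↔ P.block i < 0 := by
  have ho : P.block (opp i) = -P.block i := P.block_opp i
  constructor
  · intro hi
    have : i ≤ opp i := by rw [← Subtype.coe_le_coe, opp_val]; omega
    have := P.monotone this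
    omega
  · intro hb
    by_contra hi
    have : opp i ≤ i := by rw [← Subtype.coe_le_coe, opp_val]; omega
    have := P.monotone this
    omega

/-- By symmetry and monotonicity of the partition, all labels of a segment other than `I_0` have the
same sign. -/
theorem sgn_eq_of_block_eq {i j : Label T n} (h : P.block i = P.block j) (h0 : P.block i ≠ 0) :
    sgn F T i = sgn F T j := by
  have h1 := P.val_neg_iff h0
  have h2 := P.val_neg_iff (i := j) (by omega)
  simp only [sgn, h1, h2, h]

theorem PreservesBlocks.exists_signs (hD : IsRookPlacement P D)
    {f : D ≃ D'} (hf : PreservesBlocks P f) {w : Equiv.Perm (Label T n)}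
    (hw : ∀ γ : D, w (opp γ.1.2) = opp (f γ).1.2) :
    ∃ c : Label T n → Fˣ, ∀ γ : D, (c γ.1.1 : F) * c (opp γ.1.2) =
      sgn F T γ.1.2 * sgn F T (f γ).1.2 := by
  classical
  let s : Label T n → Fˣ := fun i => Units.mk0 (sgn F T i) (sgn_ne_zero i)
  -- The whole correction is put on the rows `-γ.2`. It can also affect a row `γ.1` only if `γ` is
  -- antidiagonal; then the block of `γ.2` is nonzero and the correction equals `1`.
  let c : Label T n → Fˣ := fun i =>
    if ∃ γ : D, i = opp γ.1.2 then s (opp i) * s (opp (w i)) else 1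
  have hc : ∀ γ : D, (c (opp γ.1.2) : F) = sgn F T γ.1.2 * sgn F T (f γ).1.2 := fun γ => by
    simp only [c, if_pos (show ∃ β : D, opp γ.1.2 = opp β.1.2 from ⟨γ, rfl⟩)]
    simp [s, hw]
  refine ⟨c, fun γ => ?_⟩
  suffices h : (c γ.1.1 : F) = 1 by rw [h, one_mul, hc]
  by_cases h : ∃ β : D, γ.1.1 = opp β.1.2
  · obtain ⟨β, hβ⟩ := h
    obtain ⟨rfl, h2⟩ := hD.eq_of_row_opp hβ
    rw [hβ, hc, ← sgn_eq_of_block_eq (hf.snd γ).symm, sgn_mul_self]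
    have h3 := hD.block_ne _ γ.2
    rw [hβ, P.block_opp] at h3
    omega
  · simp only [c, if_neg h, Units.val_one]

/-- The condition `hc` fixes the coefficient of the first matrix unit; the coefficient of the second
one then turns `η(α)` into `η(β)` automatically. -/
theorem conj_rootVector {w : Equiv.Perm (Label T n)} (hw : ∀ i, P.block (w i) = P.block i)
    (c : Label T n → F) {α β : Label T n × Label T n} (h1 : w α.1 = β.1)
    (h2 : w (opp α.2) = opp β.2) (hc : c α.1 * c (opp α.2) = sgn F T α.2 * sgn F T β.2)
    (h : primed β = β ↔ primed α = α) :
    monomial P w c * rootVector P F α * star (monomial P w c) = rootVector P F β := by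
  have e1 := monomial_mul_unitAt_mul_star hw c α.1 α.2
  have e2 := monomial_mul_unitAt_mul_star hw c (primed α).1 (primed α).2
  simp only [primed, opp_opp, h1, h2] at e1 e2
  rw [rootVector, mul_add, add_mul, mul_smul_comm, smul_mul_assoc, rootVector]
  refine congrArg₂ (· + ·) ?_ ?_
  · refine e1.trans ?_
    rw [hc, mul_mul_mul_comm, sgn_mul_self, sgn_mul_self, one_mul, one_smul]
  · rw [show monomial P w c * unitAt P F (primed α) * star (monomial P w c) = _ from e2,
      smul_smul, mul_comm (c (opp α.2)), hc, sgn_opp_mul]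
    congr 1
    unfold eta
    simp only [h]
    split_ifs
    · simp
    · linear_combination (-(sgn F T β.1 * sgn F T β.2 * sgn F T α.1 * sgn F T α.1)) *
        sgn_mul_self (F := F) α.2 - sgn F T β.1 * sgn F T β.2 * sgn_mul_self (F := F) α.1

theorem PreservesBlocks.mem_orbit (hD : IsRookPlacement P D) (hD' : IsRookPlacement P D')
    {φ : D → Fˣ} {φ' : D' → Fˣ} {f : D ≃ D'} (hf : PreservesBlocks P f)
    (hφ : ∀ γ, φ' (f γ) = φ γ) :
    basicElement P D' hD' φ' ∈
      MulAction.orbit (ContractedGL F P) (basicElement P D hD φ) := by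
  obtain ⟨w, hwb, hw⟩ := hf.exists_perm hD hD'
  obtain ⟨c, hc⟩ := hf.exists_signs (F := F) hD fun γ => (hw γ).2
  refine ⟨monomialUnit w hwb c, Subtype.ext ?_⟩
  change monomial P w (fun i => (c i : F)) * (basicElement P D hD φ : ContractedAlgebra F P) *
    star (monomial P w fun i => (c i : F)) = _
  rw [coe_basicElement, coe_basicElement, Finset.mul_sum, Finset.sum_mul, ← f.sum_comp]
  refine Finset.sum_congr rfl fun γ _ => ?_
  rw [hφ, ← conj_rootVector hwb (fun i => (c i : F)) (hw γ).1 (hw γ).2 (hc γ)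
    (hf.primed_iff γ), mul_smul_comm, smul_mul_assoc]

end Transport

/-! ### Counting roots by blocks -/

section Counting

variable {δ : F} {D D' : Finset (Label T n × Label T n)} {φ : D → Fˣ} {φ' : D' → Fˣ}

theorem IsRoot.block_add_nonneg (P : SymPartition T n) {α : Label T n × Label T n}
    (h : IsRoot α) : 0 ≤ P.block α.1 + P.block α.2 := by
  have h1 : opp α.2 ≤ α.1 := by
    rw [← Subtype.coe_le_coe, opp_val]
    have := h.add_nonneg
    omega
  have := P.monotone h1
  rw [P.block_opp] at this
  omega

theorem IsBasicPair.primed_eq_iff (h : IsBasicPair P δ D φ) (γ : D) :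
    primed γ.1 = γ.1 ↔ T = Series.C ∧ P.block γ.1.1 + P.block γ.1.2 = 0 := by
  constructor
  · intro e
    refine ⟨(h.1.isRoot _ γ.2).eq_C e, ?_⟩
    rw [primed_eq_self_iff.1 e, P.block_opp]
    omega
  · rintro ⟨hT, hb⟩
    exact primed_eq_self_iff.2 (((h.2.2 hT).2.2 (P.block γ.1.1)).1 γ ⟨rfl, by omega⟩)

/-- Roots lie in blocks with `k + m ≥ 0`, and `primed` negates this sum, so pairs of `D'` do not
reach such a block. -/
theorem blockRank_of_pos (hD : IsRookPlacement P D) {k m : ℤ} (h : 0 < k + m) :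
    blockRank P D k m = (D.filter (InBlock P k m)).card := by
  unfold blockRank
  congr 1
  ext γ
  simp only [Finset.mem_filter, mem_symmetrized, InBlock]
  constructor
  · rintro ⟨h1 | h1, h2, h3⟩
    · exact ⟨h1, h2, h3⟩
    · have := (hD.isRoot _ h1).block_add_nonneg P
      simp only [primed, P.block_opp] at this
      omega
  · rintro ⟨h1, h2⟩
    exact ⟨Or.inl h1, h2⟩

/-- Here `primed` preserves the block. In the series `C` it fixes the roots of `D` there, by the
condition (3) of a basic pair; in the other series no root is fixed, and each one is counted twice.
-/
theorem IsBasicPair.blockRank_of_eq_neg (h : IsBasicPair P δ D φ) {k m : ℤ} (hkm : k + m = 0) :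
    blockRank P D k m = (if T = Series.C then 1 else 2) * (D.filter (InBlock P k m)).card := by
  unfold blockRank
  have hb : ∀ γ, InBlock P k m (primed γ) ↔ InBlock P k m γ := fun γ => by
    simp only [InBlock, primed, P.block_opp]
    omega
  split_ifs with hT
  · rw [one_mul]
    congr 1
    ext γ
    simp only [Finset.mem_filter, mem_symmetrized]
    refine and_congr_left fun h2 => ⟨fun h1 => h1.elim id fun h1 => ?_, Or.inl⟩
    have h3 := (h.primed_eq_iff ⟨_, h1⟩).2 ⟨hT, by
      obtain ⟨e1, e2⟩ := (hb γ).2 h2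
      change P.block (primed γ).1 + P.block (primed γ).2 = 0
      omega⟩
    simp only [primed_primed] at h3
    exact h3 ▸ h1
  · have hd : Disjoint (D.filter (InBlock P k m)) ((D.filter (InBlock P k m)).image primed) := by
      rw [Finset.disjoint_left]
      intro γ h1 h2
      obtain ⟨β, h3, rfl⟩ := Finset.mem_image.1 h2
      have hβ := h.1.isRoot _ (Finset.mem_filter.1 h3).1
      exact hT (hβ.eq_C (hβ.primed_eq (h.1.isRoot _ (Finset.mem_filter.1 h1).1)))
    have hu : (symmetrized D).filter (InBlock P k m) =
        D.filter (InBlock P k m) ∪ (D.filter (InBlock P k m)).image primed := by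
      rw [symmetrized, Finset.filter_union, Finset.filter_image]
      simp only [hb]
    rw [hu, Finset.card_union_of_disjoint hd,
      Finset.card_image_of_injective _ (Function.LeftInverse.injective primed_primed), two_mul]

theorem IsBasicPair.card_filter_inBlock_eq (h : IsBasicPair P δ D φ)
    (h' : IsBasicPair P δ D' φ')
    (hr : ∀ k m : ℤ, |k| ≤ P.ℓ → |m| ≤ P.ℓ → k ≠ m → blockRank P D k m = blockRank P D' k m)
    (k m : ℤ) : (D.filter (InBlock P k m)).card = (D'.filter (InBlock P k m)).card := by
  by_cases hkm : |k| ≤ P.ℓ ∧ |m| ≤ P.ℓ ∧ k ≠ m ∧ 0 ≤ k + m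
  · have e := hr k m hkm.1 hkm.2.1 hkm.2.2.1
    rcases hkm.2.2.2.lt_or_eq with h0 | h0
    · rwa [blockRank_of_pos h.1 h0, blockRank_of_pos h'.1 h0] at e
    · rw [h.blockRank_of_eq_neg h0.symm, h'.blockRank_of_eq_neg h0.symm] at e
      exact Nat.eq_of_mul_eq_mul_left (by split_ifs <;> omega) e
  · have : ∀ E : Finset (Label T n × Label T n), IsRookPlacement P E →
        E.filter (InBlock P k m) = ∅ := fun E hE => by
      rw [Finset.filter_eq_empty_iff]
      rintro γ hγ ⟨rfl, rfl⟩
      exact hkm ⟨P.abs_block_le _, P.abs_block_le _, hE.block_ne _ hγ,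
        (hE.isRoot _ hγ).block_add_nonneg P⟩
    rw [this D h.1, this D' h'.1]

theorem card_filter_univ_inBlock (D : Finset (Label T n × Label T n)) (k m : ℤ) :
    (Finset.univ.filter fun γ : D => InBlock P k m γ.1).card =
      (D.filter (InBlock P k m)).card := by
  rw [Finset.card_filter, Finset.card_filter,
    Finset.sum_coe_sort D fun γ => if InBlock P k m γ then 1 else 0]

theorem exists_equiv_of_card_eq {α β κ : Type*} [Fintype α] [Fintype β] [DecidableEq κ]
    (s : α → κ) (t : β → κ)
    (h : ∀ c, (Finset.univ.filter fun x => s x = c).card =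
      (Finset.univ.filter fun y => t y = c).card) :
    ∃ f : α ≃ β, ∀ x, t (f x) = s x :=
  ⟨Equiv.ofFiberEquiv (f := s) (g := t) fun c => Fintype.equivOfCardEq (by
    rw [Fintype.card_subtype, Fintype.card_subtype, h]), Equiv.ofFiberEquiv_map _⟩

theorem IsBasicPair.preservesBlocks (h : IsBasicPair P δ D φ) (h' : IsBasicPair P δ D' φ')
    {f : D ≃ D'} (h1 : ∀ γ, P.block (f γ).1.1 = P.block γ.1.1)
    (h2 : ∀ γ, P.block (f γ).1.2 = P.block γ.1.2) : PreservesBlocks P f :=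
  ⟨h1, h2, fun γ => by rw [h.primed_eq_iff, h'.primed_eq_iff, h1, h2]⟩

theorem exists_preservesBlocks (h : IsBasicPair P δ D φ) (h' : IsBasicPair P δ D' φ')
    (hr : ∀ k m : ℤ, |k| ≤ P.ℓ → |m| ≤ P.ℓ → k ≠ m →
      blockRank P D k m = blockRank P D' k m) : ∃ f : D ≃ D', PreservesBlocks P f := by
  obtain ⟨f, hf⟩ := exists_equiv_of_card_eq
    (fun γ : D => (P.block γ.1.1, P.block γ.1.2))
    (fun γ : D' => (P.block γ.1.1, P.block γ.1.2)) (by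
      rintro ⟨k, m⟩
      have := h.card_filter_inBlock_eq h' hr k m
      rw [← card_filter_univ_inBlock, ← card_filter_univ_inBlock] at this
      simp only [Prod.mk.injEq]
      convert this <;> rfl)
  simp only [Prod.mk.injEq] at hf
  exact ⟨f, h.preservesBlocks h' (fun γ => (hf γ).1) fun γ => (hf γ).2⟩

theorem blockSign_eq_neg_one_iff {k : ℤ} :
    blockSign P δ D φ k = -1 ↔ ∃ γ : D, InBlock P k (-k) γ.1 ∧ (φ γ : F) = δ := by
  unfold blockSign
  split_ifs with h <;> simp [h]

theorem blockSign_eq_iff {k : ℤ} : blockSign P δ D φ k = blockSign P δ D' φ' k ↔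
    ((∃ γ : D, InBlock P k (-k) γ.1 ∧ (φ γ : F) = δ) ↔
      ∃ γ : D', InBlock P k (-k) γ.1 ∧ (φ' γ : F) = δ) := by
  unfold blockSign
  split_ifs with a b b
  · exact iff_of_true rfl (iff_of_true a b)
  · exact iff_of_false (by decide) fun e => b (e.1 a)
  · exact iff_of_false (by decide) fun e => a (e.2 b)
  · exact iff_of_true rfl (iff_of_false a b)

theorem IsBasicPair.eq_delta (h : IsBasicPair P δ D φ) (hδ : δ ≠ 1) {γ : D}
    (hγ : (φ γ : F) = δ) : T = Series.C ∧ γ.1.2 = opp γ.1.1 := by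
  have hT : T = Series.C := by
    by_contra hT
    exact hδ (by rw [← hγ, h.2.1 hT]; rfl)
  exact ⟨hT, (h.2.2 hT).2.1 γ hγ⟩

theorem IsBasicPair.eq_one_of_ne (h : IsBasicPair P δ D φ) {γ : D}
    (hγ : (φ γ : F) ≠ δ) : (φ γ : F) = 1 := by
  by_cases hT : T = Series.C
  · exact ((h.2.2 hT).1 γ).resolve_right hγ
  · rw [h.2.1 hT]; rfl

open Classical in
theorem IsBasicPair.card_filter_delta (h : IsBasicPair P δ D φ) (hδ : δ ≠ 1) (k m : ℤ) :
    (Finset.univ.filter fun γ : D => InBlock P k m γ.1 ∧ (φ γ : F) = δ).card =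
      if m = -k ∧ blockSign P δ D φ k = -1 then 1 else 0 := by
  split_ifs with hkm
  · obtain ⟨rfl, hs⟩ := hkm
    obtain ⟨γ, h1, h2⟩ := blockSign_eq_neg_one_iff.1 hs
    rw [Finset.card_eq_one]
    refine ⟨γ, Finset.ext fun β => ?_⟩
    simp only [Finset.mem_filter, Finset.mem_univ, true_and, Finset.mem_singleton]
    constructor
    · rintro ⟨h3, h4⟩
      exact ((h.2.2 (h.eq_delta hδ h2).1).2.2 k).2 _ _ h3 h1 h4 h2
    · rintro rfl
      exact ⟨h1, h2⟩
  · rw [Finset.card_eq_zero, Finset.filter_eq_empty_iff]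
    rintro γ - ⟨⟨rfl, rfl⟩, h2⟩
    have h3 : P.block γ.1.2 = -P.block γ.1.1 := by rw [(h.eq_delta hδ h2).2, P.block_opp]
    exact hkm ⟨h3, blockSign_eq_neg_one_iff.2 ⟨γ, ⟨rfl, h3⟩, h2⟩⟩

open Classical in
theorem exists_preservesBlocks_coeff (hδ : δ ≠ 1) (h : IsBasicPair P δ D φ)
    (h' : IsBasicPair P δ D' φ')
    (hr : ∀ k m : ℤ, |k| ≤ P.ℓ → |m| ≤ P.ℓ → k ≠ m → blockRank P D k m = blockRank P D' k m)
    (hs : ∀ k : ℤ, |k| ≤ P.ℓ → k ≠ 0 → blockSign P δ D φ k = blockSign P δ D' φ' k) :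
    ∃ f : D ≃ D', PreservesBlocks P f ∧ ∀ γ, φ' (f γ) = φ γ := by
  -- For `k = 0` or `|k| > ℓ` the placement has no roots in `I_k × I_{-k}`, so both signs are `1`.
  have hs' : ∀ k, blockSign P δ D φ k = blockSign P δ D' φ' k := fun k => by
    by_cases hk : |k| ≤ P.ℓ ∧ k ≠ 0
    · exact hs k hk.1 hk.2
    · have : ∀ (E : Finset (Label T n × Label T n)) (ψ : E → Fˣ), IsRookPlacement P E →
          ¬∃ γ : E, InBlock P k (-k) γ.1 ∧ (ψ γ : F) = δ := by
        rintro E ψ hE ⟨γ, ⟨rfl, h2⟩, -⟩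
        refine hk ⟨P.abs_block_le _, fun h0 => hE.block_ne _ γ.2 ?_⟩
        omega
      rw [blockSign_eq_iff]
      exact iff_of_false (this _ _ h.1) (this _ _ h'.1)
  obtain ⟨f, hf⟩ := exists_equiv_of_card_eq
    -- The bijection also records whether the coefficient is `δ`; such roots are counted by
    -- `blockSign`, and the others by subtraction.
    (fun γ : D => (P.block γ.1.1, P.block γ.1.2, decide ((φ γ : F) = δ)))
    (fun γ : D' => (P.block γ.1.1, P.block γ.1.2, decide ((φ' γ : F) = δ))) (by
      rintro ⟨k, m, b⟩
      have e1 := h.card_filter_inBlock_eq h' hr k m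
      rw [← card_filter_univ_inBlock, ← card_filter_univ_inBlock,
        ← Finset.card_filter_add_card_filter_not (fun γ : D => (φ γ : F) = δ),
        ← Finset.card_filter_add_card_filter_not (s := Finset.univ.filter
          fun γ : D' => InBlock P k m γ.1) (fun γ : D' => (φ' γ : F) = δ)] at e1
      simp only [Finset.filter_filter] at e1
      have e2 := h.card_filter_delta hδ k m
      rw [hs' k, ← h'.card_filter_delta hδ k m] at e2
      have e3 := e1
      rw [e2, Nat.add_left_cancel_iff] at e3
      simp only [InBlock, and_assoc] at e2 e3
      cases b
      · simpa only [Prod.mk.injEq, decide_eq_false_iff_not] using e3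
      · simpa only [Prod.mk.injEq, decide_eq_true_eq] using e2)
  simp only [Prod.mk.injEq, decide_eq_decide] at hf
  refine ⟨f, h.preservesBlocks h' (fun γ => (hf γ).1) fun γ => (hf γ).2.1, fun γ => ?_⟩
  apply Units.ext
  by_cases hγ : (φ γ : F) = δ
  · rw [hγ, (hf γ).2.2.2 hγ]
  · rw [h.eq_one_of_ne hγ, h'.eq_one_of_ne (mt (hf γ).2.2.1 hγ)]

/-- Together with `PreservesBlocks.mem_orbit`, this reduces the invariance of signs to two
coefficient functions on one placement. -/
theorem IsBasicPair.comp_symm (hδ : δ ≠ 1) (h : IsBasicPair P δ D φ)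
    (h' : IsBasicPair P δ D' φ') {f : D ≃ D'} (hf : PreservesBlocks P f) :
    IsBasicPair P δ D' (φ ∘ f.symm) := by
  refine ⟨h'.1, fun hT γ => h.2.1 hT _, fun hT => ⟨fun γ => (h.2.2 hT).1 _, fun γ hγ => ?_,
    fun k => ⟨((h'.2.2 hT).2.2 k).1, fun γ γ' h1 h2 h3 h4 => ?_⟩⟩⟩
  · have h1 := (hf.primed_iff _).2 (primed_eq_self_iff.2 (h.eq_delta hδ hγ).2)
    rw [f.apply_symm_apply] at h1
    exact primed_eq_self_iff.1 h1
  · have hb : ∀ β : D', InBlock P k (-k) β.1 → InBlock P k (-k) (f.symm β).1 := fun β hβ => by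
      have e1 := hf.fst (f.symm β)
      have e2 := hf.snd (f.symm β)
      rw [f.apply_symm_apply] at e1 e2
      exact ⟨e1.symm.trans hβ.1, e2.symm.trans hβ.2⟩
    exact f.symm.injective (((h.2.2 hT).2.2 k).2 _ _ (hb _ h1) (hb _ h2) h3 h4)

theorem PreservesBlocks.blockSign_comp_symm {f : D ≃ D'} (hf : PreservesBlocks P f) (k : ℤ) :
    blockSign P δ D' (φ ∘ f.symm) k = blockSign P δ D φ k := by
  rw [blockSign_eq_iff]
  refine (f.exists_congr fun γ => ?_).symm
  simp [InBlock, hf.fst, hf.snd]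

end Counting

/-! ### Invariance of the signs -/

section Signs

variable {δ : F} {D : Finset (Label T n × Label T n)} {hD : IsRookPlacement P D} {φ ψ : D → Fˣ}

/-- The map `γ ↦ γ'` on the pairs of `D ∪ D'` in a symmetric set of blocks. -/
def primedEquiv (P : SymPartition T n) {C : ℤ → ℤ → Prop} [DecidableRel C]
    (hs : ∀ a b, C a b → C (-b) (-a)) (D : Finset (Label T n × Label T n)) :
    rooksIn P C D ≃ rooksIn P C D :=
  have h : ∀ γ ∈ rooksIn P C D, primed γ ∈ rooksIn P C D := fun γ hγ => by
    rw [mem_rooksIn] at hγ ⊢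
    refine ⟨primed_mem_symmetrized hγ.1, ?_⟩
    simp only [primed, P.block_opp]
    exact hs _ _ hγ.2
  ⟨fun γ => ⟨primed γ.1, h _ γ.2⟩, fun γ => ⟨primed γ.1, h _ γ.2⟩,
    fun γ => Subtype.ext (primed_primed _), fun γ => Subtype.ext (primed_primed _)⟩

theorem restrict_star {C : ℤ → ℤ → Prop} [DecidableRel C] (hs : ∀ a b, C a b → C (-b) (-a))
    (X : ContractedAlgebra F P) (i j : Label T n) :
    restrict C (star X) i j = sgn F T i * sgn F T j * restrict C X (opp j) (opp i) := by
  have h : C (-P.block j) (-P.block i) ↔ C (P.block i) (P.block j) :=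
    ⟨fun h => by simpa using hs _ _ h, hs _ _⟩
  simp only [restrict, Matrix.of_apply, entry_star, P.block_opp, h]
  split_ifs <;> simp

theorem exists_prod_entry_eq (h : basicElement P D hD ψ ∈
      MulAction.orbit (ContractedGL F P) (basicElement P D hD φ))
    {C : ℤ → ℤ → Prop} [DecidableRel C] (hC : IsInterval C) (hs : ∀ a b, C a b → C (-b) (-a)) :
    ∃ d : F, ∏ s ∈ rooksIn P C D,
        entry (basicElement P D hD ψ : ContractedAlgebra F P) s.1 s.2 =
      d ^ 2 * ∏ s ∈ rooksIn P C D,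
        entry (basicElement P D hD φ : ContractedAlgebra F P) s.1 s.2 := by
  obtain ⟨g, hg⟩ := h
  replace hg := congrArg (fun X : nilSpace F P => restrict C (X : ContractedAlgebra F P)) hg
  simp only [coe_smul_nilSpace, restrict_mul hC] at hg
  set S := rooksIn P C D with hS
  have hentry : ∀ χ : D → Fˣ, ∏ s ∈ S,
      entry (basicElement P D hD χ : ContractedAlgebra F P) s.1 s.2 =
      (Matrix.diagonal fun s : S =>
        restrict C (basicElement P D hD χ : ContractedAlgebra F P) s.1.1 s.1.2).det := by
    intro χ
    rw [Matrix.det_diagonal, ← Finset.prod_coe_sort]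
    refine Finset.prod_congr rfl fun s _ => ?_
    simp [restrict, (mem_rooksIn.1 s.2).2]
  set G : Matrix S S F := (restrict C (g : ContractedAlgebra F P)).submatrix
    (fun s : S => s.1.1) (fun s : S => s.1.1) with hG
  -- The negative of the column of `s` is the row of `primed s`, so the entries of `g†` at columns
  -- of rooks are entries of `g` at rows of rooks.
  have hH : (restrict C (star (g : ContractedAlgebra F P))).submatrix
      (fun s : S => s.1.2) (fun s : S => s.1.2) =
      Matrix.diagonal (fun s : S => sgn F T s.1.2) *
        (G.submatrix (primedEquiv P hs D) (primedEquiv P hs D)).transpose *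
        Matrix.diagonal (fun s : S => sgn F T s.1.2) := by
    ext s t
    rw [Matrix.mul_diagonal, Matrix.diagonal_mul, Matrix.submatrix_apply, restrict_star hs]
    simp only [hG, Matrix.transpose_apply, Matrix.submatrix_apply, primedEquiv, Equiv.coe_fn_mk,
      primed]
    ring
  refine ⟨G.det, ?_⟩
  rw [hentry ψ, hentry φ, ← submatrix_eq_diagonal (restrict_basicElement_ne_zero_iff hD ψ)
    (fun α hα β hβ => hD.row α (mem_rooksIn.1 hα).1 β (mem_rooksIn.1 hβ).1)
    (fun α hα β hβ => hD.col α (mem_rooksIn.1 hα).1 β (mem_rooksIn.1 hβ).1), ← hg,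
    submatrix_mul_mul fun i j => (restrict_basicElement_ne_zero_iff hD φ i j).1,
    hH, Matrix.det_mul, Matrix.det_mul, Matrix.det_mul, Matrix.det_mul, Matrix.det_transpose,
    Matrix.det_submatrix_equiv_self]
  have h1 : (Matrix.diagonal fun s : S => sgn F T s.1.2).det *
      (Matrix.diagonal fun s : S => sgn F T s.1.2).det = 1 := by
    rw [Matrix.det_diagonal, ← Finset.prod_mul_distrib]
    exact Finset.prod_eq_one fun s _ => sgn_mul_self _
  linear_combination (G.det ^ 2 * (Matrix.diagonal fun s : S =>
        restrict C (basicElement P D hD φ : ContractedAlgebra F P) s.1.1 s.1.2).det) * h1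

/-- The extension of `φ` by `1`. -/
def coeff (φ : D → Fˣ) (γ : Label T n × Label T n) : F :=
  if h : γ ∈ D then φ ⟨γ, h⟩ else 1

theorem coeff_ne_zero (φ : D → Fˣ) (γ : Label T n × Label T n) : coeff φ γ ≠ 0 := by
  unfold coeff
  split_ifs <;> simp

/-- A coefficient `δ` occurs only at antidiagonal roots, so the entries at pairs of `D'` outside `D`
do not depend on `φ`, and `coeff` may be `1` there. -/
theorem IsBasicPair.entry_eq_coeff_mul (hδ : δ ≠ 1) (h : IsBasicPair P δ D φ)
    {γ : Label T n × Label T n} (hγ : γ ∈ symmetrized D) :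
    entry (basicElement P D hD φ : ContractedAlgebra F P) γ.1 γ.2 =
      coeff φ γ * entry (basicElement P D hD (1 : D → Fˣ) : ContractedAlgebra F P) γ.1 γ.2 := by
  by_cases h0 : γ ∈ D
  · have h1 := entry_basicElement_of_mem hD φ ⟨γ, h0⟩
    have h2 := entry_basicElement_of_mem hD (1 : D → Fˣ) ⟨γ, h0⟩
    simp only at h1 h2
    simp [h1, h2, coeff, h0]
  · have h1 : primed γ ∈ D := (mem_symmetrized.1 hγ).resolve_left h0
    have h2 : primed (primed γ) ≠ primed γ := by
      rw [primed_primed]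
      exact fun h => h0 (h ▸ h1)
    have h3 := entry_basicElement_primed hD φ ⟨_, h1⟩ h2
    have h4 := entry_basicElement_primed hD (1 : D → Fˣ) ⟨_, h1⟩ h2
    have h5 : (φ ⟨_, h1⟩ : F) = 1 := h.eq_one_of_ne fun e =>
      h2 (primed_eq_self_iff.2 (h.eq_delta hδ e).2)
    simp only [primed_primed] at h3 h4
    simp [h3, h4, coeff, h0, h5]

theorem isSquare_prod_coeff (hδ : δ ≠ 1) (hφ : IsBasicPair P δ D φ) (hψ : IsBasicPair P δ D ψ)
    (h : basicElement P D hD ψ ∈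
      MulAction.orbit (ContractedGL F P) (basicElement P D hD φ))
    {C : ℤ → ℤ → Prop} [DecidableRel C] (hC : IsInterval C) (hs : ∀ a b, C a b → C (-b) (-a)) :
    IsSquare ((∏ γ ∈ rooksIn P C D, coeff φ γ) * ∏ γ ∈ rooksIn P C D, coeff ψ γ) := by
  obtain ⟨d, hd⟩ := exists_prod_entry_eq h hC hs
  rw [Finset.prod_congr rfl fun γ hγ => hφ.entry_eq_coeff_mul hδ (mem_rooksIn.1 hγ).1,
    Finset.prod_congr rfl fun γ hγ => hψ.entry_eq_coeff_mul hδ (mem_rooksIn.1 hγ).1,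
    Finset.prod_mul_distrib, Finset.prod_mul_distrib, ← mul_assoc] at hd
  have h0 : ∏ γ ∈ rooksIn P C D,
      entry (basicElement P D hD (1 : D → Fˣ) : ContractedAlgebra F P) γ.1 γ.2 ≠ 0 :=
    Finset.prod_ne_zero_iff.2 fun γ hγ =>
      (entry_basicElement_ne_zero_iff hD (1 : D → Fˣ) γ).2 (mem_rooksIn.1 hγ).1
  refine ⟨d * ∏ γ ∈ rooksIn P C D, coeff φ γ, ?_⟩
  rw [mul_right_cancel₀ h0 hd]
  ring

open Classical in
theorem IsBasicPair.prod_coeff_sdiff (hδ : δ ≠ 1) (h : IsBasicPair P δ D φ) {k : ℤ}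
    {C C' : ℤ → ℤ → Prop} [DecidableRel C] [DecidableRel C']
    (hk : ∀ a, a ≠ 0 → (C a (-a) ∧ ¬C' a (-a) ↔ a = k)) :
    ∏ γ ∈ rooksIn P C D \ rooksIn P C' D, coeff φ γ =
      if blockSign P δ D φ k = -1 then δ else 1 := by
  have hmem : ∀ γ : D, γ.1.2 = opp γ.1.1 →
      (γ.1 ∈ rooksIn P C D \ rooksIn P C' D ↔ InBlock P k (-k) γ.1) := fun γ hγ => by
    have hb : P.block γ.1.2 = -P.block γ.1.1 := by rw [hγ, P.block_opp]
    have h0 := h.1.block_ne _ γ.2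
    rw [hb] at h0
    have := hk (P.block γ.1.1) (by omega)
    have hm : γ.1 ∈ symmetrized D := mem_symmetrized.2 (Or.inl γ.2)
    simp only [Finset.mem_sdiff, mem_rooksIn, hm, true_and, hb, this, InBlock]
    omega
  have hone : ∀ γ : Label T n × Label T n, γ ∈ rooksIn P C D \ rooksIn P C' D →
      (∀ β : D, InBlock P k (-k) β.1 → (φ β : F) = δ → β.1 ≠ γ) → coeff φ γ = 1 := by
    intro γ hγ hβ
    unfold coeff
    split_ifs with h0
    · refine h.eq_one_of_ne fun e => hβ ⟨γ, h0⟩ ?_ e rfl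
      exact (hmem ⟨γ, h0⟩ (h.eq_delta hδ e).2).1 hγ
    · rfl
  split_ifs with hs
  · obtain ⟨γ, h1, h2⟩ := blockSign_eq_neg_one_iff.1 hs
    rw [Finset.prod_eq_single γ.1]
    · simp [coeff, h2]
    · intro β hβ hne
      refine hone β hβ fun α h3 h4 e => hne ?_
      rw [← e, ((h.2.2 (h.eq_delta hδ h2).1).2.2 k).2 _ _ h3 h1 h4 h2]
    · exact fun h3 => absurd ((hmem γ (h.eq_delta hδ h2).2).2 h1) h3
  · refine Finset.prod_eq_one fun γ hγ => hone γ hγ fun β h1 h2 _ => hs ?_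
    exact blockSign_eq_neg_one_iff.2 ⟨β, h1, h2⟩

theorem blockSign_eq_of_intervals (hδ : ¬IsSquare δ) (hφ : IsBasicPair P δ D φ)
    (hψ : IsBasicPair P δ D ψ)
    (h : basicElement P D hD ψ ∈
      MulAction.orbit (ContractedGL F P) (basicElement P D hD φ)) {k : ℤ}
    {C C' : ℤ → ℤ → Prop} [DecidableRel C] [DecidableRel C'] (hC : IsInterval C)
    (hC' : IsInterval C') (hs : ∀ a b, C a b → C (-b) (-a)) (hs' : ∀ a b, C' a b → C' (-b) (-a))
    (hle : ∀ a b, C' a b → C a b) (hk : ∀ a, a ≠ 0 → (C a (-a) ∧ ¬C' a (-a) ↔ a = k)) :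
    blockSign P δ D φ k = blockSign P δ D ψ k := by
  classical
  have hδ1 : δ ≠ 1 := fun e => hδ (e ▸ IsSquare.one)
  have hsub : rooksIn P C' D ⊆ rooksIn P C D := fun γ hγ => by
    rw [mem_rooksIn] at hγ ⊢
    exact ⟨hγ.1, hle _ _ hγ.2⟩
  have hne : ∀ χ : D → Fˣ, ∏ γ ∈ rooksIn P C' D, coeff χ γ ≠ 0 := fun χ =>
    Finset.prod_ne_zero_iff.2 fun γ _ => coeff_ne_zero χ γ
  have h1 := isSquare_prod_coeff hδ1 hφ hψ h hC hs
  have h2 := isSquare_prod_coeff hδ1 hφ hψ h hC' hs'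
  rw [← Finset.prod_sdiff hsub, ← Finset.prod_sdiff hsub, hφ.prod_coeff_sdiff hδ1 hk,
    hψ.prod_coeff_sdiff hδ1 hk, mul_mul_mul_comm] at h1
  -- Dividing out the smaller interval leaves the product of the contributions of `I_k × I_{-k}` for
  -- `φ` and `ψ`, each `δ` or `1`; if they differed, `δ` would be a square.
  have h3 := h1.div h2
  rw [mul_div_cancel_right₀ _ (mul_ne_zero (hne _) (hne _))] at h3
  rw [blockSign_eq_iff, ← blockSign_eq_neg_one_iff, ← blockSign_eq_neg_one_iff]
  by_cases e1 : blockSign P δ D φ k = -1 <;> by_cases e2 : blockSign P δ D ψ k = -1 <;>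
    simp_all

theorem blockSign_eq_of_mem_orbit (hδ : ¬IsSquare δ) (hφ : IsBasicPair P δ D φ)
    (hψ : IsBasicPair P δ D ψ)
    (h : basicElement P D hD ψ ∈
      MulAction.orbit (ContractedGL F P) (basicElement P D hD φ)) {k : ℤ} (hk : k ≠ 0) :
    blockSign P δ D φ k = blockSign P δ D ψ k := by
  rcases hk.lt_or_gt with hk | hk
  · refine blockSign_eq_of_intervals hδ hφ hψ h (isInterval_wrapped (p := k) (q := -k) (by omega))
      (isInterval_wrapped (p := k - 1) (q := -(k - 1)) (by omega)) ?_ ?_ ?_ ?_ <;>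
      unfold Wrapped <;> intros <;> omega
  · refine blockSign_eq_of_intervals hδ hφ hψ h (isInterval_straight k (-k))
      (isInterval_straight (k - 1) (-(k - 1))) ?_ ?_ ?_ ?_ <;>
      unfold Straight <;> intros <;> omega

end Signs

end ParabolicContraction

end

/-! ### The classification of orbits of basic elements -/

theorem mainTheorem6 (F : Type*) [Field F] [Finite F] (hF : ringChar F ≠ 2)
    (δ : F) (hδ : ¬ IsSquare δ)
    (T : ParabolicContraction.Series) (n : ℕ) (P : ParabolicContraction.SymPartition T n)
    (D D' : Finset (ParabolicContraction.Label T n × ParabolicContraction.Label T n))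
    (φ : D → Fˣ) (φ' : D' → Fˣ)
    (h : ParabolicContraction.IsBasicPair P δ D φ)
    (h' : ParabolicContraction.IsBasicPair P δ D' φ') :
    ParabolicContraction.basicElement P D' h'.1 φ' ∈
        MulAction.orbit (ParabolicContraction.ContractedGL F P)
          (ParabolicContraction.basicElement P D h.1 φ) ↔
      (∀ k m : ℤ, |k| ≤ P.ℓ → |m| ≤ P.ℓ → k ≠ m →
        ParabolicContraction.blockRank P D k m = ParabolicContraction.blockRank P D' k m) ∧
      (∀ k : ℤ, |k| ≤ P.ℓ → k ≠ 0 →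
        ParabolicContraction.blockSign P δ D φ k = ParabolicContraction.blockSign P δ D' φ' k) := by
  have hδ1 : δ ≠ 1 := fun e => hδ (e ▸ IsSquare.one)
  constructor
  · intro ho
    have hr := ParabolicContraction.blockRank_eq_of_mem_orbit ho
    refine ⟨fun k m _ _ _ => hr k m, fun k _ hk => ?_⟩
    -- The ranks already agree, so `D` can be moved onto `D'` within the orbit, carrying `φ` along
    -- without changing the signs.
    obtain ⟨f, hf⟩ := ParabolicContraction.exists_preservesBlocks h h' fun k m _ _ _ => hr k m
    have ht := hf.mem_orbit h.1 h'.1 (φ := φ) (φ' := φ ∘ f.symm) (by simp)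
    rw [← hf.blockSign_comp_symm k]
    refine ParabolicContraction.blockSign_eq_of_mem_orbit (hD := h'.1) hδ (h.comp_symm hδ1 h' hf)
      h' ?_ hk
    rwa [MulAction.orbit_eq_iff.2 ht]
  · rintro ⟨hr, hs⟩
    obtain ⟨f, hf, hφ⟩ :=
      ParabolicContraction.exists_preservesBlocks_coeff hδ1 h h' hr hs
    exact hf.mem_orbit h.1 h'.1 hφ
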